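/- Let $N\ge 1$ and $\alpha\in(0,2)$. For $h>0$ put $z_\beta=h\beta$ ($\beta\in\mathbb Z^N$) and $$\Delta_h\psi(x)=\sum_{i=1}^N\frac{\psi(x+he_i)-2\psi(x)+\psi(x-he_i)}{h^2}.$$ For bounded $\psi:\mathbb R^N\to\mathbb R$ let $$e^{t\Delta_h}\psi(x)=\sum_{\beta\in\mathbb Z^N}\psi(x-z_\beta)\,G\Big(\beta,\frac{t}{h^2}\Big),\qquad G(\beta,t)=e^{-2Nt}\prod_{i=1}^N I_{|\beta_i|}(2t),$$ where $I_m$ is the modified Bessel function of the first kind of order $m$, and let $$(-\Delta_h)^{\alpha/2}[\psi](x)=\frac1{\Gamma(-\frac\alpha2)}\int_0^\infty\big(e^{t\Delta_h}\psi(x)-\psi(x)\big)\frac{dt}{t^{1+\alpha/2}},\qquad \omega_{\beta,h}=\frac1{h^\alpha}\frac1{|\Gamma(-\frac\alpha2)|}\int_0^\infty G(\beta,t)\frac{dt}{t^{1+\alpha/2}}\quad(\beta\neq0).$$ Let $-(-\Delta)^{\alpha/2}$ be the fractional Laplacian, that is, $$-(-\Delta)^{\alpha/2}[\psi](x)=\int_{\mathbb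 R^N\setminus\{0\}}\big(\psi(x+z)-\psi(x)-z\cdot D\psi(x)\mathbf 1_{|z|\le1}\big)\frac{c_{N,\alpha}\,dz}{|z|^{N+\alpha}},\qquad c_{N,\alpha}=\frac{2^\alpha\,\Gamma(\frac{N+\alpha}2)}{\pi^{N/2}|\Gamma(-\frac\alpha2)|}.$$ Then the following holds. (a) Let $h>0$ and let $\psi:\mathbb R^N\to\mathbb R$ be bounded. Then $\Psi(x,t)=e^{t\Delta_h}\psi(x)$ is the unique solution of $\partial_t\Psi=\Delta_h\Psi$ on $\mathbb R^N\times(0,\infty)$ with $\Psi(\cdot,0)=\psi$ that is continuous in $t\ge0$ for each $x$ and bounded on $\mathbb R^N\times[0,T]$ for every $T>0$. The integral defining $(-\Delta_h)^{\alpha/2}[\psi](x)$ converges absolutely for every $x$, and $$-(-\Delta_h)^{\alpha/2}[\psi](x)=\sum_{\beta\ne0}\big(\psi(x+z_\beta)-\psi(x)\big)\,\omega_{\beta,h}.$$ (b) The family $\{-(-\Delta_h)^{\alpha/2}\}_{h>0}$ is an admissible approximation of $-(-\Delta)^{\alpha/2}$, which means: (i) for every $h>0$, $\omega_{\beta,h}=\omega_{-\beta,h}\ge0$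 for $\beta\ne0$, the measure $\nu_h=\sum_{\beta\neq0}\omega_{\beta,h}\,\delta_{z_\beta}$ is finite and symmetric, and $-(-\Delta_h)^{\alpha/2}[\psi](x)=\int_{|z|>0}(\psi(x+z)-\psi(x))\,d\nu_h(z)$ for all bounded Borel $\psi$ and all $x$; (ii) $\big\|(-\Delta)^{\alpha/2}[\psi]-(-\Delta_h)^{\alpha/2}[\psi]\big\|_{L^1(\mathbb R^N)}\to0$ as $h\to0^+$ for every $\psi\in C_c^\infty(\mathbb R^N)$; (iii) $\displaystyle\sup_{0<h<1}\ \sum_{\beta\neq0}\min(|z_\beta|^2,1)\,\omega_{\beta,h}<\infty.$ (c) The local truncation error is $O(h^2)$ in $L^1$ and in $L^\infty$: for every $\psi\in C_c^\infty(\mathbb R^N)$ and $p\in\{1,\infty\}$ there is a constant $C$ such that for all $h>0$ the difference $(-\Delta_h)^{\alpha/2}[\psi]-(-\Delta)^{\alpha/2}[\psi]$ lies in $L^p(\mathbb R^N)$ and $$\big\|(-\Delta_h)^{\alpha/2}[\psi]-(-\Delta)^{\alpha/2}[\psi]\big\|_{L^p(\mathbb R^N)}\le C\,h^2.$$ -/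

import Mathlib

open MeasureTheory Set Filter Topology
open scoped ENNReal NNReal Nat

noncomputable section

/-- The grid point `z_β = h β` of the uniform grid `h ℤ^N` in `ℝ^N`. -/
def gridPoint {N : ℕ} (h : ℝ) (β : Fin N → ℤ) : EuclideanSpace ℝ (Fin N) :=
  WithLp.toLp 2 (fun i => h * (β i : ℝ))

/-- The discrete Laplacian
`Δ_h ψ(x) = h⁻² ∑_i (ψ(x + h e_i) - 2 ψ(x) + ψ(x - h e_i))`, acting on functions on `ℝ^N`. -/
def discLaplacian {N : ℕ} (h : ℝ) (ψ : EuclideanSpace ℝ (Fin N) → ℝ)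
    (x : EuclideanSpace ℝ (Fin N)) : ℝ :=
  ∑ i : Fin N, (ψ (x + h • EuclideanSpace.single i (1 : ℝ)) - 2 * ψ x
    + ψ (x - h • EuclideanSpace.single i (1 : ℝ))) / h ^ 2

/-- The modified Bessel function of the first kind of order `m ∈ ℕ`,
`I_m(x) = ∑_k (x/2)^(2k+m) / (k! (k+m)!)`. -/
def modifiedBesselI (m : ℕ) (x : ℝ) : ℝ :=
  ∑' k : ℕ, (x / 2) ^ (2 * k + m) / ((k ! : ℝ) * ((k + m)! : ℝ))

/-- The fundamental solution of the semi-discrete heat equation on `ℤ^N`,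
`G(β, t) = e^{-2Nt} ∏_i I_{|β_i|}(2t)`. -/
def latticeHeatKernel {N : ℕ} (β : Fin N → ℤ) (t : ℝ) : ℝ :=
  Real.exp (-(2 * (N : ℝ) * t)) * ∏ i : Fin N, modifiedBesselI (β i).natAbs (2 * t)

/-- `Ψ` is a solution, bounded on `ℝ^N × [0, T]` for every `T`, of the semi-discrete heat equation
`∂_t Ψ = Δ_h Ψ` on `ℝ^N × (0, ∞)` with `Ψ(·, 0) = ψ`. -/
structure IsSemidiscreteHeatSolution {N : ℕ} (h : ℝ) (ψ : EuclideanSpace ℝ (Fin N) → ℝ)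
    (Ψ : ℝ → EuclideanSpace ℝ (Fin N) → ℝ) : Prop where
  initial : Ψ 0 = ψ
  continuousOn : ∀ x, ContinuousOn (fun t => Ψ t x) (Ici 0)
  hasDerivAt : ∀ t, 0 < t → ∀ x, HasDerivAt (fun s => Ψ s x) (discLaplacian h (Ψ t) x) t
  bounded : ∀ T : ℝ, ∃ M : ℝ, ∀ t ∈ Icc 0 T, ∀ x, |Ψ t x| ≤ M

/-- The semi-discrete heat semigroup
`e^{tΔ_h} ψ(x) = ∑_β ψ(x - z_β) G(β, t / h²)`. -/
def discHeatSemigroup {N : ℕ} (h t : ℝ) (ψ : EuclideanSpace ℝ (Fin N) → ℝ)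
    (x : EuclideanSpace ℝ (Fin N)) : ℝ :=
  ∑' β : Fin N → ℤ, ψ (x - gridPoint h β) * latticeHeatKernel β (t / h ^ 2)

/-- The power of the discrete Laplacian, by subordination:
`(-Δ_h)^{α/2} ψ(x) = Γ(-α/2)⁻¹ ∫_0^∞ (e^{tΔ_h} ψ(x) - ψ(x)) dt / t^{1+α/2}`. -/
def fracDiscLaplacian {N : ℕ} (α h : ℝ) (ψ : EuclideanSpace ℝ (Fin N) → ℝ)
    (x : EuclideanSpace ℝ (Fin N)) : ℝ :=
  1 / Real.Gamma (-(α / 2)) *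
    ∫ t in Ioi (0 : ℝ), (discHeatSemigroup h t ψ x - ψ x) / t ^ (1 + α / 2)

/-- The weights of `-(-Δ_h)^{α/2}` as a difference operator,
`h^{-α} |Γ(-α/2)|⁻¹ ∫_0^∞ G(β, t) dt / t^{1+α/2}`. Note that `Γ(-α/2) < 0` for `0 < α < 2`. -/
def fracDiscWeight {N : ℕ} (α h : ℝ) (β : Fin N → ℤ) : ℝ :=
  1 / h ^ α * (1 / |Real.Gamma (-(α / 2))|) *
    ∫ t in Ioi (0 : ℝ), latticeHeatKernel β t / t ^ (1 + α / 2)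

/-- The Lévy operator
`ψ ↦ ∫_{z ≠ 0} (ψ(x+z) - ψ(x) - z · Dψ(x) 1_{|z| ≤ 1}) dμ(z)`. -/
def levyOperator {N : ℕ} (μ : Measure (EuclideanSpace ℝ (Fin N)))
    (ψ : EuclideanSpace ℝ (Fin N) → ℝ) (x : EuclideanSpace ℝ (Fin N)) : ℝ :=
  ∫ z in ({0}ᶜ : Set (EuclideanSpace ℝ (Fin N))),
    (ψ (x + z) - ψ x - (Metric.closedBall 0 1).indicator (fun z => fderiv ℝ ψ x z) z) ∂μ

/-- The Lévy measure `c_{N,α} |z|^{-N-α} dz` of the fractional Laplacian, with the usual constant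
`c_{N,α} = 2^α Γ((N+α)/2) / (π^{N/2} |Γ(-α/2)|)`. -/
def fracLevyMeasure (N : ℕ) (α : ℝ) : Measure (EuclideanSpace ℝ (Fin N)) :=
  volume.withDensity fun z => ENNReal.ofReal
    (2 ^ α * Real.Gamma (((N : ℝ) + α) / 2)
      / (Real.pi ^ ((N : ℝ) / 2) * |Real.Gamma (-(α / 2))|) / ‖z‖ ^ ((N : ℝ) + α))

/-- The fractional Laplacian `(-Δ)^{α/2}`: minus the Lévy operator of `c_{N,α} |z|^{-N-α} dz`. -/
def fracLaplacian {N : ℕ} (α : ℝ) (ψ : EuclideanSpace ℝ (Fin N) → ℝ)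
    (x : EuclideanSpace ℝ (Fin N)) : ℝ :=
  -levyOperator (fracLevyMeasure N α) ψ x

/-- The measure `ν_h = ∑_{β ≠ 0} ω_β δ_{z_β}` with `z_β = h β`. -/
def gridMeasure {N : ℕ} (h : ℝ) (ω : (Fin N → ℤ) → ℝ) : Measure (EuclideanSpace ℝ (Fin N)) :=
  Measure.sum fun β : {β : Fin N → ℤ // β ≠ 0} =>
    ENNReal.ofReal (ω β) • Measure.dirac (gridPoint h (β : Fin N → ℤ))

/-- The family `{L^h}_{h>0}` is an admissible discretization of the operator `L`, with weights
`ω_{β,h}` (`β ≠ 0`) at the grid points `z_β = h β`. -/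
structure IsAdmissibleDiscretization {N : ℕ}
    (L : (EuclideanSpace ℝ (Fin N) → ℝ) → EuclideanSpace ℝ (Fin N) → ℝ)
    (Lh : ℝ → (EuclideanSpace ℝ (Fin N) → ℝ) → EuclideanSpace ℝ (Fin N) → ℝ)
    (ω : ℝ → (Fin N → ℤ) → ℝ) : Prop where
  /-- (i) nonnegative weights -/
  nonneg : ∀ h, 0 < h → ∀ β, β ≠ 0 → 0 ≤ ω h β
  /-- (i) symmetric weights -/
  symm : ∀ h, 0 < h → ∀ β, β ≠ 0 → ω h (-β) = ω h β
  /-- (i) the measure `ν_h` is symmetric -/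
  map_neg : ∀ h, 0 < h → (gridMeasure h (ω h)).map (fun z => -z) = gridMeasure h (ω h)
  /-- (i) the measure `ν_h` is finite -/
  finite : ∀ h, 0 < h → IsFiniteMeasure (gridMeasure h (ω h))
  /-- (i) `L^h` is the Lévy operator `ψ ↦ ∫_{|z|>0} (ψ(x+z) - ψ(x)) dν_h(z)` of `ν_h` -/
  eq_levy : ∀ h, 0 < h → ∀ ψ : EuclideanSpace ℝ (Fin N) → ℝ, Measurable ψ →
    (∃ M : ℝ, ∀ x, |ψ x| ≤ M) → ∀ x,
      Lh h ψ x = ∫ z in ({0}ᶜ : Set (EuclideanSpace ℝ (Fin N))),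
        (ψ (x + z) - ψ x) ∂(gridMeasure h (ω h))
  /-- (ii) consistency in `L¹` -/
  consistent : ∀ ψ : EuclideanSpace ℝ (Fin N) → ℝ, ContDiff ℝ (⊤ : ℕ∞) ψ → HasCompactSupport ψ →
    Tendsto (fun h => eLpNorm (fun x => L ψ x - Lh h ψ x) 1 volume) (𝓝[>] 0) (𝓝 0)
  /-- (iii) the uniform Lévy condition -/
  uniform_levy : (⨆ h ∈ Ioo (0 : ℝ) 1, ∑' β : {β : Fin N → ℤ // β ≠ 0},
    ENNReal.ofReal (min (‖gridPoint h (β : Fin N → ℤ)‖ ^ 2) 1 * ω h β)) < ⊤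

end

open MeasureTheory Set Filter Topology
open scoped ENNReal NNReal Nat

noncomputable section

variable {N : ℕ}

local notation "𝔼" => EuclideanSpace ℝ (Fin N)

/-! ### Modified Bessel functions -/

/-! Subordination reduces every claim to one about heat semigroups. The discrete fractional
Laplacian is by definition an integral of `e^{tΔ_h}ψ - ψ` against `dt / t^{1+α/2}`. The fractional
Laplacian has the same form with the Gaussian semigroup, because integrating the heat kernel in time
gives exactly the density `c_{N,α} |z|^{-N-α}` (`integral_heatKernel_div_rpow`,
`levyOperator_fracLevyMeasure_eq`). Up to the factor `1/|Γ(-α/2)|`, the truncation error is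
therefore the time integral of `e^{tΔ}ψ - e^{tΔ_h}ψ`.

Discrete side: the Bessel recurrences make the product kernel a solution of the lattice heat
equation, and a comparison principle (`abs_le_of_semidiscrete_heat`) gives uniqueness. Uniqueness
applied to constants shows that the kernel has mass one. Since `min(|x|²,1)` has discrete Laplacian
at most `2N`, its average under the kernel is at most `min(2Nt,1)` for every `h`; this gives
summability of the weights, the difference formula and the uniform Lévy bound.

Sup norm error: `w = e^{tΔ}ψ - e^{tΔ_h}ψ` solves the semi-discrete equation with source
`(Δ-Δ_h)e^{tΔ}ψ`. Taylor expansion bounds the source by `h²` times pure fourth derivatives of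
`e^{tΔ}ψ`. These are bounded for small `t` and, by Gaussian smoothing of `∂_i²ψ`, of size `1/t` for
large `t`. So the source is `O(h²/(1+t))` and `w` is `O(h² log(1+t))`, which is integrable against
`dt / t^{1+α/2}` exactly because `0 < α < 2`.

`L¹` error: by duality it suffices to test against compactly supported `g` with `|g| ≤ 1`. Both
operators commute with translations, so the tested error is the pointwise error at `0` for the
average `∫ g(x) ψ(x + ·) dx`. Derivatives of this average are bounded by `L¹` norms of derivatives
of `ψ`, so the sup norm estimate yields the `L¹` estimate. -/

theorem summable_pow_div_factorial_mul_factorial (m : ℕ) (T : ℝ) :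
    Summable fun k : ℕ => T ^ (2 * k + m) / ((k ! : ℝ) * ((k + m)! : ℝ)) := by
  have h := ((Real.summable_pow_div_factorial (|T| ^ 2)).mul_left (|T| ^ m / (m ! : ℝ)))
  refine Summable.of_norm_bounded h fun k => ?_
  rw [norm_div, norm_pow, Real.norm_eq_abs, Real.norm_eq_abs,
    abs_of_pos (by positivity : 0 < (k ! : ℝ) * ((k + m)! : ℝ)),
    div_mul_div_comm, ← pow_mul, ← pow_add, add_comm m]
  have : (m ! : ℝ) ≤ ((k + m)! : ℝ) := by exact_mod_cast Nat.factorial_le (by omega)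
  rw [mul_comm (m ! : ℝ)]
  gcongr

theorem modifiedBesselI_two_mul (m : ℕ) (t : ℝ) :
    modifiedBesselI m (2 * t) = ∑' k : ℕ, t ^ (2 * k + m) / ((k ! : ℝ) * ((k + m)! : ℝ)) := by
  simp [modifiedBesselI]

/-- From `(k+m)! ≥ m!` and the exponential series. The factor `T^m / m!` is the decay in the order
that makes lattice sums converge, locally uniformly in time. -/
theorem abs_modifiedBesselI_two_mul_le (m : ℕ) {t T : ℝ} (h : |t| ≤ T) :
    |modifiedBesselI m (2 * t)| ≤ T ^ m / (m ! : ℝ) * Real.exp (T ^ 2) := by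
  have hs := ((Real.summable_pow_div_factorial (T ^ 2)).mul_left (T ^ m / (m ! : ℝ)))
  have hT : 0 ≤ T := (abs_nonneg t).trans h
  rw [modifiedBesselI_two_mul, Real.exp_eq_exp_ℝ, NormedSpace.exp_eq_tsum_div, ← tsum_mul_left,
    ← Real.norm_eq_abs]
  refine tsum_of_norm_bounded hs.hasSum fun k => ?_
  rw [norm_div, norm_pow, Real.norm_eq_abs, Real.norm_eq_abs,
    abs_of_pos (by positivity : 0 < (k ! : ℝ) * ((k + m)! : ℝ)),
    div_mul_div_comm, ← pow_mul, ← pow_add, add_comm m]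
  have : (m ! : ℝ) ≤ ((k + m)! : ℝ) := by exact_mod_cast Nat.factorial_le (by omega)
  rw [mul_comm (m ! : ℝ)]
  gcongr

theorem modifiedBesselI_nonneg (m : ℕ) {t : ℝ} (ht : 0 ≤ t) : 0 ≤ modifiedBesselI m t :=
  tsum_nonneg fun k => by positivity

theorem modifiedBesselI_zero_right (m : ℕ) : modifiedBesselI m 0 = if m = 0 then 1 else 0 := by
  unfold modifiedBesselI
  rw [tsum_eq_single 0]
  · by_cases hm : m = 0 <;> simp [hm]
  · intro k hk
    rw [zero_div, zero_pow (by omega), zero_div]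

/-- Term by term differentiation of the power series of a modified Bessel function. -/
theorem hasDerivAt_modifiedBesselI_two_mul_tsum (m : ℕ) (t : ℝ) :
    HasDerivAt (fun t => modifiedBesselI m (2 * t))
      (∑' k : ℕ, ((2 * k + m : ℕ) : ℝ) * t ^ (2 * k + m - 1) / ((k ! : ℝ) * ((k + m)! : ℝ))) t := by
  have hT : 0 < |t| + 1 := by positivity
  set T := |t| + 1
  -- Majorant of the differentiated series: doubling the radius absorbs the factor `n ≤ 2^n`, and
  -- dividing by `T` accounts for the exponent lowered by one.
  have hs : Summable fun k : ℕ => (2 * T) ^ (2 * k + m) / ((k ! : ℝ) * ((k + m)! : ℝ)) / T :=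
    (summable_pow_div_factorial_mul_factorial m (2 * T)).div_const T
  have hfun : (fun t => modifiedBesselI m (2 * t)) =
      fun t => ∑' k : ℕ, t ^ (2 * k + m) / ((k ! : ℝ) * ((k + m)! : ℝ)) :=
    funext (modifiedBesselI_two_mul m)
  rw [hfun]
  refine hasDerivAt_tsum_of_isPreconnected (y₀ := 0) (t := Metric.ball (0 : ℝ) T)
    (g := fun (k : ℕ) (t : ℝ) => t ^ (2 * k + m) / ((k ! : ℝ) * ((k + m)! : ℝ)))
    (g' := fun (k : ℕ) (t : ℝ) =>
      ((2 * k + m : ℕ) : ℝ) * t ^ (2 * k + m - 1) / ((k ! : ℝ) * ((k + m)! : ℝ))) hs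
    Metric.isOpen_ball (convex_ball (0 : ℝ) T).isPreconnected (fun k y _ => ?_) (fun k y hy => ?_)
    (Metric.mem_ball_self hT) ?_ ?_
  · exact (hasDerivAt_pow (2 * k + m) y).div_const _
  · rw [mem_ball_zero_iff, Real.norm_eq_abs] at hy
    rw [norm_div, norm_mul, norm_pow, Real.norm_eq_abs, Real.norm_eq_abs, Real.norm_eq_abs,
      abs_of_nonneg (Nat.cast_nonneg _), abs_of_pos (by positivity : 0 < (k ! : ℝ) * ((k + m)! : ℝ)),
      div_right_comm]
    gcongr
    rcases Nat.eq_zero_or_pos (2 * k + m) with h0 | h0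
    · rw [h0]; simp [hT.le]
    · rw [le_div_iff₀ hT, mul_assoc, mul_pow]
      have h1 : |y| ^ (2 * k + m - 1) * T ≤ T ^ (2 * k + m) := by
        calc _ ≤ T ^ (2 * k + m - 1) * T := by gcongr
          _ = T ^ (2 * k + m) := by rw [← pow_succ, Nat.sub_add_cancel h0]
      have h2 : ((2 * k + m : ℕ) : ℝ) ≤ 2 ^ (2 * k + m) := by
        exact_mod_cast (Nat.lt_two_pow_self).le
      gcongr
  · exact summable_pow_div_factorial_mul_factorial m 0
  · simp [T]

/-- Split the exponent as `2k+m+1 = (k+m+1) + k`. The first summand cancels against `(k+m+1)!` and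
gives `I_m`; the second cancels against `k!` and, after an index shift, gives `I_{m+2}`. -/
theorem hasDerivAt_modifiedBesselI_two_mul_succ (m : ℕ) (t : ℝ) :
    HasDerivAt (fun t => modifiedBesselI (m + 1) (2 * t))
      (modifiedBesselI m (2 * t) + modifiedBesselI (m + 2) (2 * t)) t := by
  convert hasDerivAt_modifiedBesselI_two_mul_tsum (m + 1) t using 1
  have h1 := summable_pow_div_factorial_mul_factorial m t
  have h2 := summable_pow_div_factorial_mul_factorial (m + 2) t
  have h3 : HasSum (fun k : ℕ => (k : ℝ) * t ^ (2 * k + m) / ((k ! : ℝ) * ((k + (m + 1))! : ℝ)))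
      (modifiedBesselI (m + 2) (2 * t)) := by
    rw [modifiedBesselI_two_mul, ← hasSum_nat_add_iff' 1]
    simp only [Finset.range_one, Finset.sum_singleton, Nat.cast_zero, zero_mul, zero_div, sub_zero]
    convert! h2.hasSum using 2 with k
    have e : k + 1 + (m + 1) = k + (m + 2) := by ring
    rw [e, Nat.factorial_succ k]
    push_cast
    field_simp
    ring
  rw [modifiedBesselI_two_mul m, ← (h1.hasSum.add h3).tsum_eq]
  refine tsum_congr fun k => ?_
  have e : 2 * k + (m + 1) - 1 = 2 * k + m := by omega
  rw [e, ← add_assoc, Nat.factorial_succ (k + m)]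
  push_cast
  field_simp
  ring

/-- At order zero both neighbours `±1` have absolute value one, so the recurrence produces `I_1`
twice. -/
theorem hasDerivAt_modifiedBesselI_two_mul_zero (t : ℝ) :
    HasDerivAt (fun t => modifiedBesselI 0 (2 * t)) (2 * modifiedBesselI 1 (2 * t)) t := by
  convert hasDerivAt_modifiedBesselI_two_mul_tsum 0 t using 1
  symm
  refine HasSum.tsum_eq ?_
  rw [modifiedBesselI_two_mul, ← hasSum_nat_add_iff' 1]
  simp only [Finset.range_one, Finset.sum_singleton, mul_zero, add_zero, Nat.cast_zero, zero_mul,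
    zero_div, sub_zero]
  convert! (summable_pow_div_factorial_mul_factorial 1 t).hasSum.mul_left 2 using 2 with k
  have e : 2 * (k + 1) - 1 = 2 * k + 1 := by omega
  rw [e, Nat.factorial_succ k]
  push_cast
  field_simp

/-! ### The heat kernel on `ℤ` -/

/-- The one-dimensional semi-discrete heat kernel `e^{-2t} I_{|m|}(2t)`. -/
def intHeatKernel (m : ℤ) (t : ℝ) : ℝ := Real.exp (-(2 * t)) * modifiedBesselI m.natAbs (2 * t)

theorem intHeatKernel_neg (m : ℤ) (t : ℝ) : intHeatKernel (-m) t = intHeatKernel m t := by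
  simp [intHeatKernel]

/-- The Bessel recurrence supplies the two neighbours and the factor `e^{-2t}` the term `-2`. The
sign of `m` decides which neighbour has the larger absolute value. -/
theorem hasDerivAt_intHeatKernel (m : ℤ) (t : ℝ) :
    HasDerivAt (intHeatKernel m)
      (intHeatKernel (m + 1) t - 2 * intHeatKernel m t + intHeatKernel (m - 1) t) t := by
  have hexp : HasDerivAt (fun t : ℝ => Real.exp (-(2 * t))) (-2 * Real.exp (-(2 * t))) t := by
    simpa [mul_comm] using ((hasDerivAt_id t).const_mul (-2)).exp
  have key : HasDerivAt (fun t => modifiedBesselI m.natAbs (2 * t))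
      (modifiedBesselI (m + 1).natAbs (2 * t) + modifiedBesselI (m - 1).natAbs (2 * t)) t := by
    rcases lt_trichotomy m 0 with h | h | h
    · obtain ⟨n, rfl⟩ : ∃ n : ℕ, m = -((n : ℤ) + 1) := ⟨(-m - 1).toNat, by omega⟩
      rw [show (-((n : ℤ) + 1)).natAbs = n + 1 by omega,
        show (-((n : ℤ) + 1) + 1).natAbs = n by omega,
        show (-((n : ℤ) + 1) - 1).natAbs = n + 2 by omega]
      exact hasDerivAt_modifiedBesselI_two_mul_succ n t
    · subst h
      exact (hasDerivAt_modifiedBesselI_two_mul_zero t).congr_deriv (two_mul _)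
    · obtain ⟨n, rfl⟩ : ∃ n : ℕ, m = (n : ℤ) + 1 := ⟨(m - 1).toNat, by omega⟩
      rw [show ((n : ℤ) + 1).natAbs = n + 1 by omega,
        show ((n : ℤ) + 1 + 1).natAbs = n + 2 by omega,
        show ((n : ℤ) + 1 - 1).natAbs = n by omega, add_comm (modifiedBesselI (n + 2) _)]
      exact hasDerivAt_modifiedBesselI_two_mul_succ n t
  refine (hexp.mul key).congr_deriv ?_
  simp only [intHeatKernel]
  ring

/-- A summable majorant of the one-dimensional semi-discrete heat kernel on `[-T, T]`. -/
def intHeatBound (T : ℝ) (m : ℤ) : ℝ :=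
  Real.exp (2 * T) * (T ^ m.natAbs / (m.natAbs ! : ℝ) * Real.exp (T ^ 2))

theorem abs_intHeatKernel_le (m : ℤ) {t T : ℝ} (h : |t| ≤ T) :
    |intHeatKernel m t| ≤ intHeatBound T m := by
  rw [intHeatKernel, intHeatBound, abs_mul, Real.abs_exp]
  have := neg_abs_le t
  gcongr
  · linarith
  · exact abs_modifiedBesselI_two_mul_le _ h

theorem summable_intHeatBound (T : ℝ) : Summable (intHeatBound T) := by
  refine Summable.mul_left _ (Summable.mul_right _ ?_)
  refine Summable.of_nat_of_neg ?_ ?_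
  · simpa using Real.summable_pow_div_factorial T
  · simpa using Real.summable_pow_div_factorial T

theorem summable_prod_pi {N : ℕ} {f : ℤ → ℝ} (h0 : ∀ m, 0 ≤ f m) (hf : Summable f) :
    Summable fun β : Fin N → ℤ => ∏ i, f (β i) := by
  induction N with
  | zero => exact Summable.of_finite
  | succ n ih =>
    rw [← (Fin.consEquiv fun _ : Fin (n + 1) => ℤ).summable_iff]
    have := hf.mul_of_nonneg ih h0 (fun β => Finset.prod_nonneg fun i _ => h0 _)
    refine this.congr fun p => ?_
    simp [Fin.prod_univ_succ, Fin.consEquiv]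


/-! ### The product heat kernel on `ℤ^N` -/

theorem latticeHeatKernel_eq_prod (β : Fin N → ℤ) (t : ℝ) :
    latticeHeatKernel β t = ∏ i, intHeatKernel (β i) t := by
  simp only [latticeHeatKernel, intHeatKernel, Finset.prod_mul_distrib, Finset.prod_const,
    Finset.card_univ, Fintype.card_fin, ← Real.exp_nat_mul]
  congr 2
  ring

theorem latticeHeatKernel_neg (β : Fin N → ℤ) (t : ℝ) :
    latticeHeatKernel (-β) t = latticeHeatKernel β t := by
  simp [latticeHeatKernel_eq_prod, intHeatKernel_neg]

theorem latticeHeatKernel_nonneg (β : Fin N → ℤ) {t : ℝ} (ht : 0 ≤ t) :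
    0 ≤ latticeHeatKernel β t :=
  mul_nonneg (Real.exp_nonneg _)
    (Finset.prod_nonneg fun _ _ => modifiedBesselI_nonneg _ (by positivity))

theorem latticeHeatKernel_zero_right (β : Fin N → ℤ) :
    latticeHeatKernel β 0 = if β = 0 then 1 else 0 := by
  simp only [latticeHeatKernel, mul_zero, neg_zero, Real.exp_zero, one_mul,
    modifiedBesselI_zero_right, Int.natAbs_eq_zero]
  split_ifs with h
  · simp [h]
  · obtain ⟨i, hi⟩ := Function.ne_iff.mp h
    exact Finset.prod_eq_zero (Finset.mem_univ i) (if_neg hi)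

/-- A summable majorant of the semi-discrete heat kernel on `[-T, T]`. -/
def latticeHeatBound (T : ℝ) (β : Fin N → ℤ) : ℝ := ∏ i, intHeatBound T (β i)

theorem abs_latticeHeatKernel_le (β : Fin N → ℤ) {t T : ℝ} (h : |t| ≤ T) :
    |latticeHeatKernel β t| ≤ latticeHeatBound T β := by
  rw [latticeHeatKernel_eq_prod, Finset.abs_prod, latticeHeatBound]
  exact Finset.prod_le_prod (fun _ _ => abs_nonneg _) fun i _ => abs_intHeatKernel_le _ h

theorem summable_latticeHeatBound {T : ℝ} (hT : 0 ≤ T) :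
    Summable (latticeHeatBound T : (Fin N → ℤ) → ℝ) :=
  summable_prod_pi (fun m => by unfold intHeatBound; positivity) (summable_intHeatBound T)

/-- The semi-discrete heat equation on `ℤ^N` for the kernel. -/
theorem hasDerivAt_latticeHeatKernel (β : Fin N → ℤ) (t : ℝ) :
    HasDerivAt (latticeHeatKernel β)
      (∑ i, (latticeHeatKernel (β + Pi.single i 1) t - 2 * latticeHeatKernel β t
        + latticeHeatKernel (β - Pi.single i 1) t)) t := by
  have h := HasDerivAt.fun_finsetProd (𝕜 := ℝ) (𝔸' := ℝ) (u := Finset.univ)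
    (fun i _ => hasDerivAt_intHeatKernel (β i) t)
  rw [← show latticeHeatKernel β = fun t => ∏ i, intHeatKernel (β i) t from
    funext (latticeHeatKernel_eq_prod β)] at h
  refine h.congr_deriv (Eq.symm ?_)
  refine Finset.sum_congr rfl fun i _ => ?_
  -- A shift in direction `i` alters one factor only; the cases `c = 1, 0, -1` are the three terms
  -- of the second difference.
  have key : ∀ c : ℤ, latticeHeatKernel (β + Pi.single i c) t
      = (∏ j ∈ Finset.univ.erase i, intHeatKernel (β j) t) * intHeatKernel (β i + c) t := by
    intro c
    rw [latticeHeatKernel_eq_prod, ← Finset.prod_erase_mul _ _ (Finset.mem_univ i)]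
    congr 1
    · refine Finset.prod_congr rfl fun j hj => ?_
      simp [Pi.single_eq_of_ne (Finset.ne_of_mem_erase hj)]
    · simp
  have k0 := key 0
  have km := key (-1)
  rw [Pi.single_zero, add_zero, add_zero] at k0
  rw [Pi.single_neg, ← sub_eq_add_neg, ← sub_eq_add_neg] at km
  rw [key, k0, km, smul_eq_mul]
  ring

/-! ### Elementary calculus -/

/-- A mean value inequality that only uses derivatives in the open interval. -/
theorem le_of_hasDerivAt_le {f B f' B' : ℝ → ℝ} {T : ℝ} (hT : 0 ≤ T)
    (hf : ContinuousOn f (Icc 0 T)) (hB : ContinuousOn B (Icc 0 T))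
    (hf' : ∀ t ∈ Ioo 0 T, HasDerivAt f (f' t) t) (hB' : ∀ t ∈ Ioo 0 T, HasDerivAt B (B' t) t)
    (h0 : f 0 ≤ B 0) (hle : ∀ t ∈ Ioo 0 T, f' t ≤ B' t) : f T ≤ B T := by
  have hd : ∀ t ∈ Ioo 0 T, HasDerivAt (fun t => B t - f t) (B' t - f' t) t :=
    fun t ht => (hB' t ht).sub (hf' t ht)
  have hm : MonotoneOn (fun t => B t - f t) (Icc 0 T) := by
    refine monotoneOn_of_deriv_nonneg (convex_Icc 0 T) (hB.sub hf) ?_ ?_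
    · rw [interior_Icc]
      exact fun t ht => (hd t ht).differentiableAt.differentiableWithinAt
    · rw [interior_Icc]
      intro t ht
      rw [(hd t ht).deriv]
      linarith [hle t ht]
  have := hm (left_mem_Icc.mpr hT) (right_mem_Icc.mpr hT) hT
  simp only at this
  linarith

theorem abs_le_of_abs_hasDerivAt_le {f B f' B' : ℝ → ℝ} {T : ℝ} (hT : 0 ≤ T)
    (hf : ContinuousOn f (Icc 0 T)) (hB : ContinuousOn B (Icc 0 T))
    (hf' : ∀ t ∈ Ioo 0 T, HasDerivAt f (f' t) t) (hB' : ∀ t ∈ Ioo 0 T, HasDerivAt B (B' t) t)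
    (h0 : |f 0| ≤ B 0) (hle : ∀ t ∈ Ioo 0 T, |f' t| ≤ B' t) : |f T| ≤ B T := by
  rw [abs_le]
  refine ⟨?_, le_of_hasDerivAt_le hT hf hB hf' hB' ((le_abs_self _).trans h0)
    fun t ht => (le_abs_self _).trans (hle t ht)⟩
  have := le_of_hasDerivAt_le hT hf.neg hB (fun t ht => (hf' t ht).neg) hB'
    ((neg_le_abs _).trans h0) fun t ht => (neg_le_abs _).trans (hle t ht)
  simp only [Pi.neg_apply] at this
  linarith

/-! ### The grid and the discrete Laplacian -/

theorem gridPoint_zero (h : ℝ) : gridPoint h (0 : Fin N → ℤ) = 0 := by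
  ext i; simp [gridPoint]

theorem gridPoint_neg (h : ℝ) (β : Fin N → ℤ) : gridPoint h (-β) = -gridPoint h β := by
  ext i; simp [gridPoint]

theorem gridPoint_add_single (h : ℝ) (β : Fin N → ℤ) (i : Fin N) :
    gridPoint h (β + Pi.single i 1) = gridPoint h β + h • EuclideanSpace.single i (1 : ℝ) := by
  ext j
  by_cases hj : j = i
  · subst hj; simp [gridPoint, mul_add]
  · simp [gridPoint, hj]

theorem gridPoint_sub_single (h : ℝ) (β : Fin N → ℤ) (i : Fin N) :
    gridPoint h (β - Pi.single i 1) = gridPoint h β - h • EuclideanSpace.single i (1 : ℝ) := by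
  rw [eq_sub_iff_add_eq, ← gridPoint_add_single, sub_add_cancel]

theorem gridPoint_eq_smul (h : ℝ) (β : Fin N → ℤ) : gridPoint h β = h • gridPoint 1 β := by
  ext i; simp [gridPoint]

theorem norm_gridPoint (h : ℝ) (β : Fin N → ℤ) : ‖gridPoint h β‖ = |h| * ‖gridPoint 1 β‖ := by
  rw [gridPoint_eq_smul, norm_smul, Real.norm_eq_abs]

theorem one_le_norm_gridPoint_one {β : Fin N → ℤ} (hβ : β ≠ 0) : 1 ≤ ‖gridPoint 1 β‖ := by
  obtain ⟨i, hi⟩ := Function.ne_iff.mp hβ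
  have h1 : (1 : ℝ) ≤ |(β i : ℝ)| := by exact_mod_cast Int.one_le_abs hi
  refine h1.trans ?_
  simpa [gridPoint] using PiLp.norm_apply_le (gridPoint 1 β) i

theorem gridPoint_ne_zero {h : ℝ} (hh : 0 < h) {β : Fin N → ℤ} (hβ : β ≠ 0) :
    gridPoint h β ≠ 0 := by
  rw [← norm_pos_iff, norm_gridPoint]
  have := one_le_norm_gridPoint_one hβ
  positivity

theorem abs_discLaplacian_le {h M : ℝ} (ψ : 𝔼 → ℝ) (hψ : ∀ x, |ψ x| ≤ M) (x : 𝔼) :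
    |discLaplacian h ψ x| ≤ N * (4 * M / h ^ 2) := by
  refine (Finset.abs_sum_le_sum_abs _ _).trans ?_
  refine (Finset.sum_le_card_nsmul _ _ (4 * M / h ^ 2) fun i _ => ?_).trans (by simp)
  rw [abs_div, abs_of_nonneg (sq_nonneg h)]
  gcongr
  have h1 := abs_le.mp (hψ (x + h • EuclideanSpace.single i (1 : ℝ)))
  have h2 := abs_le.mp (hψ (x - h • EuclideanSpace.single i (1 : ℝ)))
  have h3 := abs_le.mp (hψ x)
  rw [abs_le]; constructor <;> linarith

theorem discLaplacian_sub {h : ℝ} (f ψ : 𝔼 → ℝ) (x : 𝔼) :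
    discLaplacian h (fun y => f y - ψ y) x = discLaplacian h f x - discLaplacian h ψ x := by
  simp only [discLaplacian, ← Finset.sum_sub_distrib]
  refine Finset.sum_congr rfl fun i _ => ?_
  ring

/-- Comparison principle for the inhomogeneous semi-discrete heat equation. -/
theorem abs_le_of_semidiscrete_heat {h M : ℝ} (hh : 0 < h) {w r : ℝ → 𝔼 → ℝ}
    {R ρ : ℝ → ℝ} {T : ℝ} (hT : 0 ≤ T) (hw0 : ∀ x, w 0 x = 0)
    (hwc : ∀ x, ContinuousOn (fun t => w t x) (Ici 0))
    (hwd : ∀ t, 0 < t → ∀ x, HasDerivAt (fun s => w s x) (discLaplacian h (w t) x + r t x) t)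
    (hwM : ∀ t ∈ Icc 0 T, ∀ x, |w t x| ≤ M) (hR0 : 0 ≤ R 0) (hRc : ContinuousOn R (Ici 0))
    (hRd : ∀ t, 0 < t → HasDerivAt R (ρ t) t) (hr : ∀ t, 0 < t → ∀ x, |r t x| ≤ ρ t)
    (x : 𝔼) : |w T x| ≤ R T := by
  -- `-K` is the diagonal coefficient of `Δ_h`. The integrating factor `e^{Kt}` removes it and
  -- leaves neighbour values with nonnegative coefficients of total `K`.
  set K : ℝ := 2 * N / h ^ 2 with hK
  have hK0 : 0 ≤ K := by positivity
  have hM : 0 ≤ M := (abs_nonneg _).trans (hwM 0 (left_mem_Icc.mpr hT) x)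
  have hRnn : ∀ t, 0 ≤ t → 0 ≤ R t := by
    intro t ht
    refine le_of_hasDerivAt_le (f := fun _ => 0) (f' := fun _ => 0) ht continuousOn_const
      (hRc.mono Icc_subset_Ici_self) (fun s _ => hasDerivAt_const s 0)
      (fun s hs => hRd s hs.1) hR0 fun s hs => (abs_nonneg _).trans (hr s hs.1 x)
  have hexp : ∀ t : ℝ, HasDerivAt (fun t => Real.exp (K * t)) (Real.exp (K * t) * K) t := by
    intro t
    simpa using ((hasDerivAt_id t).const_mul K).exp
  -- Picard iteration: each integration in time improves the a priori bound `M` by one more term of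
  -- the factor `(Kt)^n / n!`, which tends to `0`. This replaces a maximum principle, since a
  -- bounded function on `ℝ^N` need not attain its supremum.
  have key : ∀ n : ℕ, ∀ t ∈ Icc 0 T, ∀ x, |w t x| ≤ R t + M * ((K * t) ^ n / (n ! : ℝ)) := by
    intro n
    induction n with
    | zero =>
      intro t ht x
      have := hwM t ht x
      have := hRnn t ht.1
      simp; linarith
    | succ n ih =>
      intro t ht x
      have hpow : ∀ s : ℝ, HasDerivAt (fun s => M * ((K * s) ^ (n + 1) / ((n + 1)! : ℝ)))
          (M * (K * ((K * s) ^ n / (n ! : ℝ)))) s := by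
        intro s
        have := ((((hasDerivAt_id s).const_mul K).pow (n + 1)).div_const
          ((n + 1)! : ℝ)).const_mul M
        refine this.congr_deriv ?_
        rw [Nat.factorial_succ]
        push_cast
        simp only [id, mul_one]
        field_simp
      have main := abs_le_of_abs_hasDerivAt_le (T := t)
        (f := fun s => Real.exp (K * s) * w s x)
        (B := fun s => Real.exp (K * s) * (R s + M * ((K * s) ^ (n + 1) / ((n + 1)! : ℝ))))
        ht.1 ?_ ?_ (fun s hs => (hexp s).mul (hwd s hs.1 x))
        (fun s hs => (hexp s).mul ((hRd s hs.1).add (hpow s))) ?_ ?_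
      · rw [abs_mul, Real.abs_exp] at main
        exact le_of_mul_le_mul_left main (Real.exp_pos _)
      · exact (by fun_prop : Continuous fun s => Real.exp (K * s)).continuousOn.mul
          ((hwc x).mono Icc_subset_Ici_self)
      · exact (by fun_prop : Continuous fun s => Real.exp (K * s)).continuousOn.mul
          ((hRc.mono Icc_subset_Ici_self).add (by fun_prop))
      · simp [hw0, hR0]
      · intro s hs
        have hsT : s ∈ Icc 0 T := ⟨hs.1.le, hs.2.le.trans ht.2⟩
        have hsplit : K * w s x + discLaplacian h (w s) x
            = ∑ i : Fin N, (w s (x + h • EuclideanSpace.single i (1 : ℝ))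
              + w s (x - h • EuclideanSpace.single i (1 : ℝ))) / h ^ 2 := by
          have : K * w s x = ∑ i : Fin N, 2 * w s x / h ^ 2 := by
            simp [hK]; ring
          rw [this, discLaplacian, ← Finset.sum_add_distrib]
          refine Finset.sum_congr rfl fun i _ => ?_
          ring
        set b := R s + M * ((K * s) ^ n / (n ! : ℝ)) with hb
        have hsum : |K * w s x + discLaplacian h (w s) x| ≤ K * b := by
          rw [hsplit]
          refine (Finset.abs_sum_le_sum_abs _ _).trans ?_
          refine (Finset.sum_le_card_nsmul _ _ (2 * b / h ^ 2) fun i _ => ?_).trans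
            (le_of_eq (by simp [hK]; ring))
          rw [abs_div, abs_of_nonneg (sq_nonneg h)]
          gcongr
          refine (abs_add_le _ _).trans ?_
          linarith [ih s hsT (x + h • EuclideanSpace.single i (1 : ℝ)),
            ih s hsT (x - h • EuclideanSpace.single i (1 : ℝ))]
        have e1 : Real.exp (K * s) * K * w s x
            + Real.exp (K * s) * (discLaplacian h (w s) x + r s x)
            = Real.exp (K * s) * ((K * w s x + discLaplacian h (w s) x) + r s x) := by ring
        have e2 : Real.exp (K * s) * K * (R s + M * ((K * s) ^ (n + 1) / ((n + 1)! : ℝ)))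
            + Real.exp (K * s) * (ρ s + M * (K * ((K * s) ^ n / (n ! : ℝ))))
            = Real.exp (K * s) * (K * b + ρ s
              + K * (M * ((K * s) ^ (n + 1) / ((n + 1)! : ℝ)))) := by rw [hb]; ring
        rw [e1, e2, abs_mul, Real.abs_exp]
        have hs0 := hs.1.le
        -- Surplus in the derivative of the majorant, left over from differentiating `e^{Ks}`; it
        -- can be discarded.
        have h3 : 0 ≤ K * (M * ((K * s) ^ (n + 1) / ((n + 1)! : ℝ))) := by positivity
        gcongr
        refine (abs_add_le _ _).trans ?_
        linarith [hr s hs.1 x]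
  have hlim : Tendsto (fun n : ℕ => R T + M * ((K * T) ^ n / (n ! : ℝ))) atTop
      (𝓝 (R T + M * 0)) :=
    ((FloorSemiring.tendsto_pow_div_factorial_atTop (K * T)).const_mul M).const_add _
  rw [mul_zero, add_zero] at hlim
  exact ge_of_tendsto' hlim fun n => key n T (right_mem_Icc.mpr hT) x

/-! ### The semi-discrete heat semigroup -/

theorem summable_mul_latticeHeatKernel {M : ℝ} {f : (Fin N → ℤ) → ℝ} (hf : ∀ β, |f β| ≤ M)
    (t : ℝ) : Summable fun β => f β * latticeHeatKernel β t := by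
  refine Summable.of_norm_bounded
    ((summable_latticeHeatBound (N := N) (abs_nonneg t)).mul_left M) fun β => ?_
  rw [norm_mul]
  exact mul_le_mul (hf β) (abs_latticeHeatKernel_le β le_rfl) (norm_nonneg _)
    ((abs_nonneg _).trans (hf 0))

theorem hasSum_discHeatSemigroup {h M : ℝ} {ψ : 𝔼 → ℝ} (hψ : ∀ x, |ψ x| ≤ M) (t : ℝ) (x : 𝔼) :
    HasSum (fun β => ψ (x - gridPoint h β) * latticeHeatKernel β (t / h ^ 2))
      (discHeatSemigroup h t ψ x) :=
  (summable_mul_latticeHeatKernel (fun _ => hψ _) _).hasSum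

/-- Reindexing by `β ↦ β + e_i` moves a shift of the kernel onto the base point, so that the lattice
equation for the kernel becomes the equation for the semigroup. -/
theorem hasSum_mul_latticeHeatKernel_add_single {h M : ℝ} {ψ : 𝔼 → ℝ} (hψ : ∀ x, |ψ x| ≤ M)
    (t : ℝ) (x : 𝔼) (i : Fin N) :
    HasSum (fun β => ψ (x - gridPoint h β) * latticeHeatKernel (β + Pi.single i 1) (t / h ^ 2))
      (discHeatSemigroup h t ψ (x + h • EuclideanSpace.single i (1 : ℝ))) := by
  convert! (Equiv.addRight (Pi.single i (1 : ℤ))).hasSum_iff.mpr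
    (hasSum_discHeatSemigroup (h := h) hψ t (x + h • EuclideanSpace.single i (1 : ℝ))) using 2
    with β
  simp only [Function.comp_apply, Equiv.coe_addRight, gridPoint_add_single]
  congr 2
  abel

theorem hasSum_mul_latticeHeatKernel_sub_single {h M : ℝ} {ψ : 𝔼 → ℝ} (hψ : ∀ x, |ψ x| ≤ M)
    (t : ℝ) (x : 𝔼) (i : Fin N) :
    HasSum (fun β => ψ (x - gridPoint h β) * latticeHeatKernel (β - Pi.single i 1) (t / h ^ 2))
      (discHeatSemigroup h t ψ (x - h • EuclideanSpace.single i (1 : ℝ))) := by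
  convert! (Equiv.subRight (Pi.single i (1 : ℤ))).hasSum_iff.mpr
    (hasSum_discHeatSemigroup (h := h) hψ t (x - h • EuclideanSpace.single i (1 : ℝ))) using 2
    with β
  simp only [Function.comp_apply, Equiv.subRight_apply, gridPoint_sub_single]
  congr 2
  abel

theorem summable_latticeHeatBound_shifts {T : ℝ} (hT : 0 ≤ T) :
    Summable fun β : Fin N → ℤ => ∑ i : Fin N,
      (latticeHeatBound T (β + Pi.single i 1) + 2 * latticeHeatBound T β
        + latticeHeatBound T (β - Pi.single i 1)) := by
  have hb := summable_latticeHeatBound (N := N) hT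
  refine summable_sum fun i _ => ?_
  have h1 : Summable fun β : Fin N → ℤ => latticeHeatBound T (β + Pi.single i 1) :=
    hb.comp_injective (add_left_injective _)
  have h2 : Summable fun β : Fin N → ℤ => latticeHeatBound T (β - Pi.single i 1) :=
    hb.comp_injective sub_left_injective
  exact (h1.add (hb.mul_left 2)).add h2

theorem abs_sum_shifts_latticeHeatKernel_le (β : Fin N → ℤ) {t T : ℝ} (ht : |t| ≤ T) :
    |∑ i, (latticeHeatKernel (β + Pi.single i 1) t - 2 * latticeHeatKernel β t
      + latticeHeatKernel (β - Pi.single i 1) t)| ≤ ∑ i : Fin N,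
      (latticeHeatBound T (β + Pi.single i 1) + 2 * latticeHeatBound T β
        + latticeHeatBound T (β - Pi.single i 1)) := by
  refine (Finset.abs_sum_le_sum_abs _ _).trans (Finset.sum_le_sum fun i _ => ?_)
  have h1 := abs_le.mp (abs_latticeHeatKernel_le (β + Pi.single i 1) ht)
  have h2 := abs_le.mp (abs_latticeHeatKernel_le β ht)
  have h3 := abs_le.mp (abs_latticeHeatKernel_le (β - Pi.single i 1) ht)
  rw [abs_le]
  constructor <;> linarith

theorem hasDerivAt_tsum_of_abs_lt {ι : Type*} {F F' : ι → ℝ → ℝ} {u : ι → ℝ} {t T : ℝ}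
    (hu : Summable u) (hF : ∀ β t, HasDerivAt (F β) (F' β t) t)
    (hb : ∀ β t, |t| < T → |F' β t| ≤ u β) (ht : |t| < T) (hs : Summable fun β => F β t) :
    HasDerivAt (fun t => ∑' β, F β t) (∑' β, F' β t) t := by
  have ht : t ∈ Metric.ball (0 : ℝ) T := mem_ball_zero_iff.mpr ht
  exact hasDerivAt_tsum_of_isPreconnected hu Metric.isOpen_ball
    (convex_ball (0 : ℝ) T).isPreconnected (fun β y _ => hF β y)
    (fun β y hy => hb β y (mem_ball_zero_iff.mp hy)) ht hs ht

theorem hasDerivAt_const_mul_latticeHeatKernel (f : (Fin N → ℤ) → ℝ) (β : Fin N → ℤ) (t : ℝ) :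
    HasDerivAt (fun t => f β * latticeHeatKernel β t)
      (f β * ∑ i, (latticeHeatKernel (β + Pi.single i 1) t - 2 * latticeHeatKernel β t
        + latticeHeatKernel (β - Pi.single i 1) t)) t :=
  (hasDerivAt_latticeHeatKernel β t).const_mul (f β)

theorem abs_mul_sum_shifts_latticeHeatKernel_le {M T : ℝ} {f : (Fin N → ℤ) → ℝ}
    (hf : ∀ β, |f β| ≤ M) (β : Fin N → ℤ) (t : ℝ) (ht : |t| < T) :
    |f β * ∑ i, (latticeHeatKernel (β + Pi.single i 1) t - 2 * latticeHeatKernel β t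
      + latticeHeatKernel (β - Pi.single i 1) t)| ≤ M * ∑ i : Fin N,
      (latticeHeatBound T (β + Pi.single i 1) + 2 * latticeHeatBound T β
        + latticeHeatBound T (β - Pi.single i 1)) := by
  rw [abs_mul]
  exact mul_le_mul (hf β) (abs_sum_shifts_latticeHeatKernel_le β ht.le) (abs_nonneg _)
    ((abs_nonneg _).trans (hf 0))

theorem hasDerivAt_tsum_mul_latticeHeatKernel {M : ℝ} {f : (Fin N → ℤ) → ℝ}
    (hf : ∀ β, |f β| ≤ M) (t : ℝ) :
    HasDerivAt (fun t => ∑' β, f β * latticeHeatKernel β t)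
      (∑' β, f β * ∑ i, (latticeHeatKernel (β + Pi.single i 1) t - 2 * latticeHeatKernel β t
        + latticeHeatKernel (β - Pi.single i 1) t)) t := by
  obtain ⟨T, hT⟩ := exists_gt |t|
  exact hasDerivAt_tsum_of_abs_lt
    ((summable_latticeHeatBound_shifts ((abs_nonneg t).trans hT.le)).mul_left M)
    (hasDerivAt_const_mul_latticeHeatKernel f) (abs_mul_sum_shifts_latticeHeatKernel_le hf)
    hT (summable_mul_latticeHeatKernel hf t)

theorem hasDerivAt_discHeatSemigroup {h M : ℝ} {ψ : 𝔼 → ℝ} (hψ : ∀ x, |ψ x| ≤ M)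
    (t : ℝ) (x : 𝔼) :
    HasDerivAt (fun t => discHeatSemigroup h t ψ x) (discLaplacian h (discHeatSemigroup h t ψ) x)
      t := by
  have h1 := (hasDerivAt_tsum_mul_latticeHeatKernel (f := fun β => ψ (x - gridPoint h β))
    (fun β => hψ _) (t / h ^ 2)).comp t ((hasDerivAt_id t).div_const (h ^ 2))
  refine h1.congr_deriv ?_
  have h2 : HasSum (fun β => ψ (x - gridPoint h β) * ∑ i,
      (latticeHeatKernel (β + Pi.single i 1) (t / h ^ 2) - 2 * latticeHeatKernel β (t / h ^ 2)
        + latticeHeatKernel (β - Pi.single i 1) (t / h ^ 2)))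
      (∑ i : Fin N, (discHeatSemigroup h t ψ (x + h • EuclideanSpace.single i (1 : ℝ))
        - 2 * discHeatSemigroup h t ψ x
        + discHeatSemigroup h t ψ (x - h • EuclideanSpace.single i (1 : ℝ)))) := by
    simp only [Finset.mul_sum]
    refine hasSum_sum fun i _ => ?_
    convert! ((hasSum_mul_latticeHeatKernel_add_single (h := h) hψ t x i).sub
      ((hasSum_discHeatSemigroup (h := h) hψ t x).mul_left 2)).add
      (hasSum_mul_latticeHeatKernel_sub_single (h := h) hψ t x i) using 2 with β
    ring
  rw [h2.tsum_eq, discLaplacian, Finset.sum_mul]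
  exact Finset.sum_congr rfl fun i _ => by ring

theorem discLaplacian_discHeatSemigroup {h M : ℝ} {ψ : 𝔼 → ℝ} (hψ : ∀ x, |ψ x| ≤ M)
    (t : ℝ) (x : 𝔼) :
    discLaplacian h (discHeatSemigroup h t ψ) x = discHeatSemigroup h t (discLaplacian h ψ) x := by
  symm
  refine HasSum.tsum_eq ?_
  simp only [discLaplacian, Finset.sum_mul]
  refine hasSum_sum fun i _ => ?_
  convert! (((hasSum_discHeatSemigroup (h := h) hψ t
    (x + h • EuclideanSpace.single i (1 : ℝ))).sub
      ((hasSum_discHeatSemigroup (h := h) hψ t x).mul_left 2)).add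
      (hasSum_discHeatSemigroup (h := h) hψ t
    (x - h • EuclideanSpace.single i (1 : ℝ)))).div_const (h ^ 2) using 2 with β
  rw [add_sub_right_comm, sub_right_comm x]
  ring

theorem discHeatSemigroup_zero (h : ℝ) (ψ : 𝔼 → ℝ) : discHeatSemigroup h 0 ψ = ψ := by
  ext x
  rw [discHeatSemigroup, tsum_eq_single 0]
  · simp [latticeHeatKernel_zero_right, gridPoint_zero]
  · intro β hβ
    simp [latticeHeatKernel_zero_right, hβ]

/-- A crude bound, depending on the time horizon, that suffices to enter the uniqueness class. The
sharp bound by `M` needs mass one, which is itself deduced from uniqueness. -/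
theorem abs_discHeatSemigroup_le_latticeHeatBound {h M : ℝ} {ψ : 𝔼 → ℝ} (hψ : ∀ x, |ψ x| ≤ M)
    {t T : ℝ} (ht : |t / h ^ 2| ≤ T) (x : 𝔼) :
    |discHeatSemigroup h t ψ x| ≤ M * ∑' β : Fin N → ℤ, latticeHeatBound T β := by
  rw [← tsum_mul_left, ← Real.norm_eq_abs, discHeatSemigroup]
  have hT := (abs_nonneg _).trans ht
  refine tsum_of_norm_bounded ((summable_latticeHeatBound hT).mul_left M).hasSum fun β => ?_
  rw [norm_mul]
  exact mul_le_mul (hψ _) (abs_latticeHeatKernel_le β ht) (norm_nonneg _)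
    ((abs_nonneg _).trans (hψ 0))

/-- The semigroup solves the semi-discrete heat equation. -/
theorem isSemidiscreteHeatSolution_discHeatSemigroup {h M : ℝ} {ψ : 𝔼 → ℝ}
    (hψ : ∀ x, |ψ x| ≤ M) :
    IsSemidiscreteHeatSolution h ψ (fun t => discHeatSemigroup h t ψ) where
  initial := discHeatSemigroup_zero h ψ
  continuousOn x := fun t _ =>
    (hasDerivAt_discHeatSemigroup hψ t x).continuousAt.continuousWithinAt
  hasDerivAt t _ x := hasDerivAt_discHeatSemigroup hψ t x
  bounded T := ⟨_, fun t ht x => abs_discHeatSemigroup_le_latticeHeatBound hψ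
    (T := T / h ^ 2) (by
      rw [abs_of_nonneg (div_nonneg ht.1 (sq_nonneg h))]
      exact div_le_div_of_nonneg_right ht.2 (sq_nonneg h)) x⟩

/-- Bounded solutions of the semi-discrete heat equation are unique. -/
theorem IsSemidiscreteHeatSolution.unique {h : ℝ} (hh : 0 < h) {ψ : 𝔼 → ℝ}
    {Ψ₁ Ψ₂ : ℝ → 𝔼 → ℝ} (h₁ : IsSemidiscreteHeatSolution h ψ Ψ₁)
    (h₂ : IsSemidiscreteHeatSolution h ψ Ψ₂) {t : ℝ} (ht : 0 ≤ t) : Ψ₁ t = Ψ₂ t := by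
  obtain ⟨M₁, hM₁⟩ := h₁.bounded t
  obtain ⟨M₂, hM₂⟩ := h₂.bounded t
  ext x
  have := abs_le_of_semidiscrete_heat (M := M₁ + M₂) hh (w := fun t x => Ψ₁ t x - Ψ₂ t x)
    (r := fun _ _ => 0) (R := fun _ => 0) (ρ := fun _ => 0) ht
    (fun x => by simp [h₁.initial, h₂.initial])
    (fun x => (h₁.continuousOn x).sub (h₂.continuousOn x))
    (fun s hs x => by
      rw [add_zero, discLaplacian_sub]
      exact (h₁.hasDerivAt s hs x).sub (h₂.hasDerivAt s hs x))
    (fun s hs x => (abs_sub _ _).trans (add_le_add (hM₁ s hs x) (hM₂ s hs x)))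
    le_rfl continuousOn_const (fun s _ => hasDerivAt_const s 0) (fun s _ x => by simp) x
  exact sub_eq_zero.mp (abs_nonpos_iff.mp this)

/-- A constant is a stationary bounded solution, so uniqueness identifies it with the semigroup.
With `c = 1` this is conservation of mass, obtained without a generating function for the Bessel
functions. -/
theorem discHeatSemigroup_const {h : ℝ} (hh : 0 < h) {t : ℝ} (ht : 0 ≤ t) (c : ℝ) (x : 𝔼) :
    discHeatSemigroup h t (fun _ => c) x = c := by
  have h2 : IsSemidiscreteHeatSolution h (fun _ : 𝔼 => c) (fun _ _ => c) :=
    { initial := rfl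
      continuousOn := fun x => continuousOn_const
      hasDerivAt := fun t _ x =>
        (hasDerivAt_const t c).congr_deriv (by
          simp [discLaplacian, show c - 2 * c + c = 0 by ring])
      bounded := fun T => ⟨|c|, fun _ _ _ => le_rfl⟩ }
  exact congr_fun ((isSemidiscreteHeatSolution_discHeatSemigroup
    (fun _ : 𝔼 => le_refl |c|)).unique hh h2 ht) x

theorem hasSum_latticeHeatKernel {t : ℝ} (ht : 0 ≤ t) :
    HasSum (fun β : Fin N → ℤ => latticeHeatKernel β t) 1 := by
  have h1 := hasSum_discHeatSemigroup (h := 1) (ψ := fun _ : 𝔼 => (1 : ℝ)) (M := 1) (by simp) t 0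
  rw [discHeatSemigroup_const one_pos ht] at h1
  simpa using h1

theorem discHeatSemigroup_mono {h M : ℝ} {f ψ : 𝔼 → ℝ} (hf : ∀ x, |f x| ≤ M)
    (hψ : ∀ x, |ψ x| ≤ M) {t : ℝ} (ht : 0 ≤ t) (hle : ∀ x, f x ≤ ψ x) (x : 𝔼) :
    discHeatSemigroup h t f x ≤ discHeatSemigroup h t ψ x :=
  hasSum_le (fun β => mul_le_mul_of_nonneg_right (hle _)
      (latticeHeatKernel_nonneg β (by positivity)))
    (hasSum_discHeatSemigroup hf t x) (hasSum_discHeatSemigroup hψ t x)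

theorem abs_discHeatSemigroup_le {h M : ℝ} (hh : 0 < h) {ψ : 𝔼 → ℝ} (hψ : ∀ x, |ψ x| ≤ M) {t : ℝ}
    (ht : 0 ≤ t) (x : 𝔼) : |discHeatSemigroup h t ψ x| ≤ M := by
  have hM : |M| = M := abs_of_nonneg ((abs_nonneg _).trans (hψ x))
  rw [abs_le]
  constructor
  · have := discHeatSemigroup_mono (h := h) (f := fun _ => -M) (M := M) (by simp [hM]) hψ ht
      (fun y => (abs_le.mp (hψ y)).1) x
    rwa [discHeatSemigroup_const hh ht] at this
  · have := discHeatSemigroup_mono (h := h) (ψ := fun _ => M) (M := M) hψ (by simp [hM]) ht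
      (fun y => (abs_le.mp (hψ y)).2) x
    rwa [discHeatSemigroup_const hh ht] at this

/-- The time derivative is `Δ_h` of a function bounded by `M`. The constant blows up as `h → 0`; it
serves only for convergence of the subordination integral near `t = 0` at fixed `h`. -/
theorem abs_discHeatSemigroup_sub_le {h M : ℝ} (hh : 0 < h) {ψ : 𝔼 → ℝ} (hψ : ∀ x, |ψ x| ≤ M)
    {t : ℝ} (ht : 0 ≤ t) (x : 𝔼) :
    |discHeatSemigroup h t ψ x - ψ x| ≤ N * (4 * M / h ^ 2) * t := by
  have hd := fun s => (hasDerivAt_discHeatSemigroup (h := h) hψ s x).sub_const (ψ x)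
  refine abs_le_of_abs_hasDerivAt_le (f := fun s => discHeatSemigroup h s ψ x - ψ x)
    (B := fun s => N * (4 * M / h ^ 2) * s) (B' := fun s => N * (4 * M / h ^ 2)) ht
    (fun s _ => (hd s).continuousAt.continuousWithinAt) (by fun_prop) (fun s _ => hd s)
    (fun s _ => by simpa using (hasDerivAt_id s).const_mul (N * (4 * M / h ^ 2))) ?_ ?_
  · simp [discHeatSemigroup_zero]
  · exact fun s hs => abs_discLaplacian_le _ (fun y => abs_discHeatSemigroup_le hh hψ hs.1.le y) x

/-! ### The truncated second moment of the semi-discrete heat kernel -/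

/-- Where `|x| ≤ 1`, compare with `|x|²`, whose second differences equal `2h²`. Where `|x| ≥ 1`, the
truncated function is at its maximum and its second differences are nonpositive. -/
theorem discLaplacian_min_sq_norm_le {h : ℝ} (hh : 0 < h) (x : 𝔼) :
    discLaplacian h (fun x : 𝔼 => min (‖x‖ ^ 2) 1) x ≤ 2 * N := by
  refine (Finset.sum_le_card_nsmul _ _ 2 fun i _ => ?_).trans (by simp [mul_comm])
  rw [div_le_iff₀ (by positivity)]
  have hp := norm_add_sq_real x (h • EuclideanSpace.single i (1 : ℝ))
  have hm := norm_sub_sq_real x (h • EuclideanSpace.single i (1 : ℝ))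
  have hn : ‖h • EuclideanSpace.single i (1 : ℝ)‖ ^ 2 = h ^ 2 := by
    simp [norm_smul]
  rw [hn] at hp hm
  beta_reduce
  rcases le_total (‖x‖ ^ 2) 1 with hx | hx
  · rw [min_eq_left hx]
    have h1 := min_le_left (‖x + h • EuclideanSpace.single i (1 : ℝ)‖ ^ 2) 1
    have h2 := min_le_left (‖x - h • EuclideanSpace.single i (1 : ℝ)‖ ^ 2) 1
    linarith
  · rw [min_eq_right hx]
    have h1 := min_le_right (‖x + h • EuclideanSpace.single i (1 : ℝ)‖ ^ 2) 1
    have h2 := min_le_right (‖x - h • EuclideanSpace.single i (1 : ℝ)‖ ^ 2) 1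
    nlinarith

theorem abs_min_sq_norm_le (x : 𝔼) : |min (‖x‖ ^ 2) 1| ≤ 1 := by
  rw [abs_of_nonneg (by positivity)]
  exact min_le_right _ _

/-- The function vanishes at `0` and its evolution has time derivative `e^{tΔ_h}Δ_h(·) ≤ 2N` by
positivity and mass one. The absence of `h` on the right is what makes the Lévy bound uniform. -/
theorem discHeatSemigroup_min_sq_norm_le {h : ℝ} (hh : 0 < h) {t : ℝ} (ht : 0 ≤ t) :
    discHeatSemigroup h t (fun x : 𝔼 => min (‖x‖ ^ 2) 1) 0 ≤ min (2 * N * t) 1 := by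
  refine le_min ?_ ((le_abs_self _).trans (abs_discHeatSemigroup_le hh abs_min_sq_norm_le ht 0))
  have hd := fun s => hasDerivAt_discHeatSemigroup (h := h) (abs_min_sq_norm_le (N := N)) s 0
  refine le_of_hasDerivAt_le (f := fun s => discHeatSemigroup h s _ 0)
    (B := fun s => 2 * N * s) (B' := fun s => 2 * N) ht
    (fun s _ => (hd s).continuousAt.continuousWithinAt) (by fun_prop) (fun s _ => hd s)
    (fun s _ => by simpa using (hasDerivAt_id s).const_mul (2 * (N : ℝ))) ?_ ?_
  · simp [discHeatSemigroup_zero]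
  · intro s hs
    rw [discLaplacian_discHeatSemigroup abs_min_sq_norm_le]
    have hM := fun x : 𝔼 => abs_discLaplacian_le (h := h) _ abs_min_sq_norm_le x
    refine (discHeatSemigroup_mono (M := max (N * (4 * 1 / h ^ 2)) (2 * N))
      (ψ := fun _ => 2 * N) (fun x => (hM x).trans (le_max_left _ _)) (fun x => ?_) hs.1.le
      (discLaplacian_min_sq_norm_le hh) 0).trans (discHeatSemigroup_const hh hs.1.le _ _).le
    rw [abs_of_nonneg (by positivity)]
    exact le_max_right _ _

theorem hasSum_min_sq_norm_mul_latticeHeatKernel (h t : ℝ) :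
    HasSum (fun β : Fin N → ℤ => min (‖gridPoint h β‖ ^ 2) 1 * latticeHeatKernel β (t / h ^ 2))
      (discHeatSemigroup h t (fun x : 𝔼 => min (‖x‖ ^ 2) 1) 0) := by
  simpa using hasSum_discHeatSemigroup (h := h) (abs_min_sq_norm_le (N := N)) t 0

/-! ### Integrability against `dt / t^{1+α/2}` -/

/-- From `Γ(s+1) = sΓ(s)` with `s = -α/2`, where `-1 < s < 0`. -/
theorem Gamma_neg_half_neg {α : ℝ} (hα : α ∈ Ioo (0 : ℝ) 2) : Real.Gamma (-(α / 2)) < 0 := by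
  obtain ⟨h0, h2⟩ := hα
  have h1 := Real.Gamma_add_one (s := -(α / 2)) (by linarith)
  have h3 : 0 < Real.Gamma (-(α / 2) + 1) := Real.Gamma_pos_of_pos (by linarith)
  rw [h1] at h3
  by_contra! h
  nlinarith

/-- The quotient is `O(t^{-α/2})` at `0`, integrable since `α < 2`, and `O(t^{γ-1-α/2})` at
infinity, integrable since `γ < α/2`. Bounded functions need only `γ = 0`; a positive `γ`
accommodates logarithmic growth. -/
theorem integrableOn_div_rpow {α γ C : ℝ} (hα : α < 2) (hγ : γ < α / 2) {f : ℝ → ℝ}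
    (hf : AEStronglyMeasurable f (volume.restrict (Ioi 0)))
    (h1 : ∀ t ∈ Ioc (0 : ℝ) 1, |f t| ≤ C * t) (h2 : ∀ t, 1 < t → |f t| ≤ C * t ^ γ) :
    IntegrableOn (fun t => f t / t ^ (1 + α / 2)) (Ioi 0) := by
  have hm : AEStronglyMeasurable (fun t => f t / t ^ (1 + α / 2)) (volume.restrict (Ioi 0)) :=
    (hf.aemeasurable.div
      (by fun_prop : Measurable fun t : ℝ => t ^ (1 + α / 2)).aemeasurable).aestronglyMeasurable
  rw [← Ioc_union_Ioi_eq_Ioi (zero_le_one (α := ℝ))] at hm ⊢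
  refine IntegrableOn.union ?_ ?_
  · have hi : IntegrableOn (fun t : ℝ => C * t ^ (-(α / 2))) (Ioc 0 1) := by
      refine Integrable.const_mul ?_ C
      exact (intervalIntegrable_iff_integrableOn_Ioc_of_le zero_le_one).mp
        (intervalIntegral.intervalIntegrable_rpow' (by linarith))
    refine Integrable.mono' hi (hm.mono_measure (Measure.restrict_mono subset_union_left le_rfl)) ?_
    refine (ae_restrict_iff' measurableSet_Ioc).mpr (Eventually.of_forall fun t ht => ?_)
    have ht0 := ht.1
    rw [norm_div, Real.norm_eq_abs, Real.norm_eq_abs, abs_of_pos (Real.rpow_pos_of_pos ht0 _),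
      div_le_iff₀ (Real.rpow_pos_of_pos ht0 _), mul_assoc, ← Real.rpow_add ht0]
    rw [show -(α / 2) + (1 + α / 2) = 1 by ring, Real.rpow_one]
    exact h1 t ht
  · have hi : IntegrableOn (fun t : ℝ => C * t ^ (γ - (1 + α / 2))) (Ioi 1) :=
      (integrableOn_Ioi_rpow_of_lt (by linarith) one_pos).const_mul C
    refine Integrable.mono' hi
      (hm.mono_measure (Measure.restrict_mono subset_union_right le_rfl)) ?_
    refine (ae_restrict_iff' measurableSet_Ioi).mpr (Eventually.of_forall fun t ht => ?_)
    have ht0 : (0 : ℝ) < t := one_pos.trans ht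
    rw [norm_div, Real.norm_eq_abs, Real.norm_eq_abs, abs_of_pos (Real.rpow_pos_of_pos ht0 _),
      div_le_iff₀ (Real.rpow_pos_of_pos ht0 _), mul_assoc, ← Real.rpow_add ht0]
    rw [sub_add_cancel]
    exact h2 t ht

theorem integrableOn_div_rpow_of_le_min {α A B : ℝ} (hα : α ∈ Ioo (0 : ℝ) 2) {f : ℝ → ℝ}
    (hf : AEStronglyMeasurable f (volume.restrict (Ioi 0)))
    (h : ∀ t, 0 < t → |f t| ≤ min (A * t) B) :
    IntegrableOn (fun t => f t / t ^ (1 + α / 2)) (Ioi 0) := by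
  refine integrableOn_div_rpow (γ := 0) (C := max A B) hα.2 (by linarith [hα.1]) hf
    (fun t ht => ?_) (fun t ht => ?_)
  · exact ((h t ht.1).trans (min_le_left _ _)).trans
      (mul_le_mul_of_nonneg_right (le_max_left _ _) ht.1.le)
  · rw [Real.rpow_zero, mul_one]
    exact ((h t (one_pos.trans ht)).trans (min_le_right _ _)).trans (le_max_right _ _)

theorem continuous_latticeHeatKernel (β : Fin N → ℤ) : Continuous (latticeHeatKernel β) :=
  continuous_iff_continuousAt.mpr fun t => (hasDerivAt_latticeHeatKernel β t).continuousAt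

theorem continuous_discHeatSemigroup {h M : ℝ} {ψ : 𝔼 → ℝ} (hψ : ∀ x, |ψ x| ≤ M) (x : 𝔼) :
    Continuous fun t => discHeatSemigroup h t ψ x :=
  continuous_iff_continuousAt.mpr fun t => (hasDerivAt_discHeatSemigroup hψ t x).continuousAt

theorem integrableOn_discHeatSemigroup_sub {α h M : ℝ} (hα : α ∈ Ioo (0 : ℝ) 2) (hh : 0 < h)
    {ψ : 𝔼 → ℝ} (hψ : ∀ x, |ψ x| ≤ M) (x : 𝔼) :
    IntegrableOn (fun t : ℝ => (discHeatSemigroup h t ψ x - ψ x) / t ^ (1 + α / 2)) (Ioi 0) := by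
  refine integrableOn_div_rpow_of_le_min (A := N * (4 * M / h ^ 2)) (B := M + M) hα
    ((continuous_discHeatSemigroup hψ x).sub continuous_const).aestronglyMeasurable fun t ht => ?_
  exact le_min (abs_discHeatSemigroup_sub_le hh hψ ht.le x)
    ((abs_sub _ _).trans (add_le_add (abs_discHeatSemigroup_le hh hψ ht.le x) (hψ x)))

/-! ### The weights -/

/-- Nonzero lattice points have norm at least one, so for `h = 1` the mass off the origin is
controlled by the truncated second moment. -/
theorem sum_latticeHeatKernel_le (s : Finset {β : Fin N → ℤ // β ≠ 0}) {t : ℝ} (ht : 0 ≤ t) :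
    ∑ β ∈ s, latticeHeatKernel (β : Fin N → ℤ) t ≤ min (2 * N * t) 1 := by
  refine le_trans ?_ (discHeatSemigroup_min_sq_norm_le one_pos ht)
  have h1 := hasSum_min_sq_norm_mul_latticeHeatKernel (N := N) 1 t
  simp only [one_pow, div_one] at h1
  have h2 : ∑ β ∈ s, latticeHeatKernel (β : Fin N → ℤ) t
      = ∑ β ∈ s.map (Function.Embedding.subtype _), latticeHeatKernel β t := by
    simp
  rw [h2]
  refine (Finset.sum_le_sum fun β hβ => ?_).trans
    (sum_le_hasSum (s.map (Function.Embedding.subtype _))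
      (fun β _ => mul_nonneg (by positivity) (latticeHeatKernel_nonneg β ht)) h1)
  obtain ⟨b, -, rfl⟩ := Finset.mem_map.mp hβ
  have hb : 1 ≤ ‖gridPoint 1 (b : Fin N → ℤ)‖ ^ 2 := one_le_pow₀ (one_le_norm_gridPoint_one b.2)
  simp only [Function.Embedding.subtype_apply]
  rw [min_eq_right hb, one_mul]

theorem integrableOn_latticeHeatKernel {α h : ℝ} (hα : α ∈ Ioo (0 : ℝ) 2)
    (β : {β : Fin N → ℤ // β ≠ 0}) :
    IntegrableOn (fun t : ℝ => latticeHeatKernel (β : Fin N → ℤ) (t / h ^ 2) / t ^ (1 + α / 2))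
      (Ioi 0) := by
  refine integrableOn_div_rpow_of_le_min (A := 2 * N * (1 / h ^ 2)) (B := 1) hα
    ((continuous_latticeHeatKernel _).comp (continuous_id.div_const _)).aestronglyMeasurable
    fun t ht => ?_
  rw [abs_of_nonneg (latticeHeatKernel_nonneg _ (by positivity))]
  have := sum_latticeHeatKernel_le {β} (t := t / h ^ 2) (by positivity)
  rw [Finset.sum_singleton] at this
  rwa [show 2 * (N : ℝ) * (1 / h ^ 2) * t = 2 * N * (t / h ^ 2) by ring]

/-- The substitution `t ↦ h² t` puts the weights on the time scale of `e^{tΔ_h}`; the prefactor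
comes from `(h²)^{1+α/2} = h² h^α`. -/
theorem fracDiscWeight_eq {α h : ℝ} (hh : 0 < h) (β : Fin N → ℤ) :
    fracDiscWeight α h β = 1 / |Real.Gamma (-(α / 2))| *
      ∫ t in Ioi (0 : ℝ), latticeHeatKernel β (t / h ^ 2) / t ^ (1 + α / 2) := by
  have hh2 : 0 < h ^ 2 := by positivity
  have h1 := integral_comp_mul_left_Ioi
    (fun t => latticeHeatKernel β (t / h ^ 2) / t ^ (1 + α / 2)) 0 hh2
  rw [mul_zero, smul_eq_mul, eq_inv_mul_iff_mul_eq₀ hh2.ne'] at h1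
  have hpow : (h ^ 2) ^ (1 + α / 2) = h ^ 2 * h ^ α := by
    rw [← Real.rpow_natCast, ← Real.rpow_mul hh.le, ← Real.rpow_add hh]
    congr 1
    push_cast
    ring
  have h2 : ∫ t in Ioi (0 : ℝ), latticeHeatKernel β (h ^ 2 * t / h ^ 2) / (h ^ 2 * t) ^ (1 + α / 2)
      = ((h ^ 2)⁻¹ * (h ^ α)⁻¹) * ∫ t in Ioi (0 : ℝ), latticeHeatKernel β t / t ^ (1 + α / 2) := by
    rw [← integral_const_mul]
    refine setIntegral_congr_fun measurableSet_Ioi fun t ht => ?_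
    have ht0 : (0 : ℝ) < t := ht
    have := Real.rpow_pos_of_pos hh α
    have := Real.rpow_pos_of_pos ht0 (1 + α / 2)
    rw [Real.mul_rpow hh2.le ht0.le, mul_div_cancel_left₀ _ hh2.ne', hpow]
    field_simp
  rw [h2] at h1
  rw [← h1, fracDiscWeight]
  have := Real.rpow_pos_of_pos hh α
  field_simp

theorem fracDiscWeight_nonneg {α h : ℝ} (hh : 0 < h) (β : Fin N → ℤ) :
    0 ≤ fracDiscWeight α h β := by
  rw [fracDiscWeight_eq hh]
  refine mul_nonneg (by positivity) (setIntegral_nonneg measurableSet_Ioi fun t ht => ?_)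
  have ht0 : (0 : ℝ) < t := ht
  exact div_nonneg (latticeHeatKernel_nonneg β (by positivity)) (by positivity)

theorem fracDiscWeight_neg (α h : ℝ) (β : Fin N → ℤ) :
    fracDiscWeight α h (-β) = fracDiscWeight α h β := by
  simp only [fracDiscWeight, latticeHeatKernel_neg]

/-- Finite partial sums are taken under the integral, where the mass bound off the origin dominates
all of them by one integrable function. -/
theorem summable_integral_latticeHeatKernel {α h : ℝ} (hα : α ∈ Ioo (0 : ℝ) 2) (hh : 0 < h) :
    Summable fun β : {β : Fin N → ℤ // β ≠ 0} =>
      ∫ t in Ioi (0 : ℝ), latticeHeatKernel (β : Fin N → ℤ) (t / h ^ 2) / t ^ (1 + α / 2) := by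
  refine summable_of_sum_le
    (c := ∫ t in Ioi (0 : ℝ), min (2 * N * (1 / h ^ 2) * t) 1 / t ^ (1 + α / 2)) (fun β => ?_)
    fun s => ?_
  · refine setIntegral_nonneg measurableSet_Ioi fun t ht => ?_
    have ht0 : (0 : ℝ) < t := ht
    exact div_nonneg (latticeHeatKernel_nonneg _ (by positivity)) (by positivity)
  · rw [← integral_finsetSum _ fun β _ => integrableOn_latticeHeatKernel hα β]
    refine setIntegral_mono_on
      (integrable_finsetSum _ fun β _ => integrableOn_latticeHeatKernel hα β)
      (integrableOn_div_rpow_of_le_min hα (by fun_prop : Measurable _).aestronglyMeasurable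
        fun t ht => (abs_of_nonneg (by positivity)).le) measurableSet_Ioi fun t ht => ?_
    have ht0 : (0 : ℝ) < t := ht
    rw [← Finset.sum_div]
    gcongr
    rw [show 2 * (N : ℝ) * (1 / h ^ 2) * t = 2 * N * (t / h ^ 2) by ring]
    exact sum_latticeHeatKernel_le s (by positivity)

/-- Summation against the weights is subordinate to summation against the heat kernel. -/
theorem hasSum_mul_fracDiscWeight {α h M : ℝ} (hα : α ∈ Ioo (0 : ℝ) 2) (hh : 0 < h)
    {c : (Fin N → ℤ) → ℝ} (hc : ∀ β, |c β| ≤ M) {S : ℝ → ℝ} (hS : ∀ t, 0 < t →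
      HasSum (fun β : {β : Fin N → ℤ // β ≠ 0} => c β * latticeHeatKernel (β : Fin N → ℤ)
        (t / h ^ 2)) (S t)) :
    HasSum (fun β : {β : Fin N → ℤ // β ≠ 0} => c β * fracDiscWeight α h (β : Fin N → ℤ))
      (1 / |Real.Gamma (-(α / 2))| * ∫ t in Ioi (0 : ℝ), S t / t ^ (1 + α / 2)) := by
  have h1 : HasSum (fun β : {β : Fin N → ℤ // β ≠ 0} => ∫ t in Ioi (0 : ℝ),
        c β * (latticeHeatKernel (β : Fin N → ℤ) (t / h ^ 2) / t ^ (1 + α / 2)))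
      (∫ t in Ioi (0 : ℝ), ∑' β : {β : Fin N → ℤ // β ≠ 0},
        c β * (latticeHeatKernel (β : Fin N → ℤ) (t / h ^ 2) / t ^ (1 + α / 2))) := by
    refine hasSum_integral_of_summable_integral_norm
      (fun β => (integrableOn_latticeHeatKernel hα β).const_mul _) ?_
    refine Summable.of_nonneg_of_le (fun β => integral_nonneg fun t => norm_nonneg _) (fun β => ?_)
      ((summable_integral_latticeHeatKernel hα hh).mul_left M)
    rw [← integral_const_mul]
    refine setIntegral_mono_on ((integrableOn_latticeHeatKernel hα β).const_mul _).norm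
      ((integrableOn_latticeHeatKernel hα β).const_mul _) measurableSet_Ioi fun t ht => ?_
    have ht0 : (0 : ℝ) < t := ht
    have h0 : 0 ≤ latticeHeatKernel (β : Fin N → ℤ) (t / h ^ 2) / t ^ (1 + α / 2) :=
      div_nonneg (latticeHeatKernel_nonneg _ (by positivity)) (by positivity)
    rw [norm_mul, Real.norm_of_nonneg h0]
    exact mul_le_mul_of_nonneg_right (hc _) h0
  have h2 : ∫ t in Ioi (0 : ℝ), ∑' β : {β : Fin N → ℤ // β ≠ 0},
        c β * (latticeHeatKernel (β : Fin N → ℤ) (t / h ^ 2) / t ^ (1 + α / 2))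
      = ∫ t in Ioi (0 : ℝ), S t / t ^ (1 + α / 2) := by
    refine setIntegral_congr_fun measurableSet_Ioi fun t ht => ?_
    refine HasSum.tsum_eq ?_
    simpa only [mul_div_assoc] using (hS t ht).div_const (t ^ (1 + α / 2))
  rw [h2] at h1
  convert! h1.mul_left (1 / |Real.Gamma (-(α / 2))|) using 2 with β
  rw [fracDiscWeight_eq hh, integral_const_mul]
  ring

theorem hasSum_ne_zero_iff {f : (Fin N → ℤ) → ℝ} {a : ℝ} (h0 : f 0 = 0) :
    HasSum (fun β : {β : Fin N → ℤ // β ≠ 0} => f β) a ↔ HasSum f a :=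
  hasSum_subtype_iff_of_support_subset (s := {β | β ≠ 0}) fun β hβ h => hβ (by rw [h, h0])

theorem hasSum_fracDiscLaplacian {α h M : ℝ} (hα : α ∈ Ioo (0 : ℝ) 2) (hh : 0 < h)
    {ψ : 𝔼 → ℝ} (hψ : ∀ x, |ψ x| ≤ M) (x : 𝔼) :
    HasSum (fun β : {β : Fin N → ℤ // β ≠ 0} =>
      (ψ (x + gridPoint h (β : Fin N → ℤ)) - ψ x) * fracDiscWeight α h (β : Fin N → ℤ))
      (-fracDiscLaplacian α h ψ x) := by
  have h1 := hasSum_mul_fracDiscWeight hα hh (c := fun β => ψ (x + gridPoint h β) - ψ x)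
    (M := M + M) (S := fun t => discHeatSemigroup h t ψ x - ψ x)
    (fun β => (abs_sub _ _).trans (add_le_add (hψ _) (hψ _))) fun t ht => ?_
  · convert h1 using 1
    rw [fracDiscLaplacian, abs_of_neg (Gamma_neg_half_neg hα)]
    ring
  · refine (hasSum_ne_zero_iff (f := fun β => (ψ (x + gridPoint h β) - ψ x) *
      latticeHeatKernel β (t / h ^ 2)) (by simp [gridPoint_zero])).mpr ?_
    have h2 := (hasSum_discHeatSemigroup (h := h) hψ t x).sub
      ((hasSum_latticeHeatKernel (N := N) (t := t / h ^ 2) (by positivity)).mul_left (ψ x))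
    rw [mul_one] at h2
    have h3 := (Equiv.neg (Fin N → ℤ)).hasSum_iff.mpr h2
    convert! h3 using 2 with β
    simp only [Function.comp_apply, Equiv.neg_apply, gridPoint_neg, latticeHeatKernel_neg,
      sub_neg_eq_add]
    ring

theorem summable_fracDiscWeight {α h : ℝ} (hα : α ∈ Ioo (0 : ℝ) 2) (hh : 0 < h) :
    Summable fun β : {β : Fin N → ℤ // β ≠ 0} => fracDiscWeight α h (β : Fin N → ℤ) := by
  simp only [fracDiscWeight_eq hh]
  exact (summable_integral_latticeHeatKernel hα hh).mul_left _

/-! ### The grid measures -/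

theorem isFiniteMeasure_gridMeasure {α h : ℝ} (hα : α ∈ Ioo (0 : ℝ) 2) (hh : 0 < h) :
    IsFiniteMeasure (gridMeasure (N := N) h (fracDiscWeight α h)) := by
  refine ⟨?_⟩
  rw [gridMeasure, Measure.sum_apply _ MeasurableSet.univ]
  simp only [Measure.smul_apply, measure_univ, smul_eq_mul, mul_one]
  exact (summable_fracDiscWeight hα hh).tsum_ofReal_lt_top

theorem gridMeasure_singleton_zero {h : ℝ} (hh : 0 < h) (ω : (Fin N → ℤ) → ℝ) :
    gridMeasure h ω {0} = 0 := by
  rw [gridMeasure, Measure.sum_apply _ (measurableSet_singleton 0)]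
  simp only [Measure.smul_apply, smul_eq_mul, ENNReal.tsum_eq_zero, mul_eq_zero]
  intro β
  right
  simp [gridPoint_ne_zero hh β.2]

theorem map_neg_gridMeasure (h : ℝ) {ω : (Fin N → ℤ) → ℝ} (hω : ∀ β, β ≠ 0 → ω (-β) = ω β) :
    (gridMeasure h ω).map (fun z => -z) = gridMeasure h ω := by
  ext s hs
  rw [Measure.map_apply measurable_neg hs, gridMeasure,
    Measure.sum_apply _ hs, Measure.sum_apply _ (measurable_neg hs)]
  rw [← Equiv.tsum_eq ((Equiv.neg (Fin N → ℤ)).subtypeEquiv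
    (p := fun β => β ≠ 0) (q := fun β => β ≠ 0) fun β => by simp)]
  refine tsum_congr fun β => ?_
  simp only [Equiv.subtypeEquiv_apply, Equiv.neg_apply, gridPoint_neg, hω _ β.2,
    Measure.smul_apply, Measure.dirac_apply' _ hs, Measure.dirac_apply' _ (measurable_neg hs)]
  congr 1
  have hiff : -gridPoint h (β : Fin N → ℤ) ∈ (fun z : 𝔼 => -z) ⁻¹' s ↔
      gridPoint h (β : Fin N → ℤ) ∈ s := by rw [mem_preimage, neg_neg]
  by_cases hβ : gridPoint h (β : Fin N → ℤ) ∈ s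
  · rw [indicator_of_mem hβ, indicator_of_mem (hiff.mpr hβ)]
    rfl
  · rw [indicator_of_notMem hβ, indicator_of_notMem (mt hiff.mp hβ)]

theorem neg_fracDiscLaplacian_eq_integral {α h M : ℝ} (hα : α ∈ Ioo (0 : ℝ) 2) (hh : 0 < h)
    {ψ : 𝔼 → ℝ} (hm : Measurable ψ) (hψ : ∀ x, |ψ x| ≤ M) (x : 𝔼) :
    -fracDiscLaplacian α h ψ x =
      ∫ z, (ψ (x + z) - ψ x) ∂(gridMeasure h (fracDiscWeight α h)) := by
  have := isFiniteMeasure_gridMeasure (N := N) hα hh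
  have hi : Integrable (fun z => ψ (x + z) - ψ x) (gridMeasure h (fracDiscWeight α h)) :=
    Integrable.of_bound (by fun_prop : Measurable _).aestronglyMeasurable (M + M)
      (Eventually.of_forall fun z => (abs_sub _ _).trans (add_le_add (hψ _) (hψ _)))
  have h1 := hasSum_integral_measure (μ := fun β : {β : Fin N → ℤ // β ≠ 0} =>
    ENNReal.ofReal (fracDiscWeight α h (β : Fin N → ℤ)) •
      Measure.dirac (gridPoint h (β : Fin N → ℤ))) hi
  refine (hasSum_fracDiscLaplacian hα hh hψ x).unique ?_
  convert! h1 using 2 with β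
  rw [integral_smul_measure, integral_dirac, ENNReal.toReal_ofReal (fracDiscWeight_nonneg hh _),
    smul_eq_mul, mul_comm]

theorem restrict_compl_zero_gridMeasure {h : ℝ} (hh : 0 < h) (ω : (Fin N → ℤ) → ℝ) :
    (gridMeasure h ω).restrict {0}ᶜ = gridMeasure h ω :=
  Measure.restrict_eq_self_of_ae_mem (by
    rw [ae_iff]
    simpa using gridMeasure_singleton_zero hh ω)

/-- Subordination applied to the truncated second moment of the kernel; the resulting bound does not
involve `h`. -/
theorem tsum_min_sq_norm_mul_fracDiscWeight_le {α h : ℝ} (hα : α ∈ Ioo (0 : ℝ) 2) (hh : 0 < h) :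
    ∑' β : {β : Fin N → ℤ // β ≠ 0},
      ENNReal.ofReal (min (‖gridPoint h (β : Fin N → ℤ)‖ ^ 2) 1 *
        fracDiscWeight α h (β : Fin N → ℤ)) ≤
    ENNReal.ofReal (1 / |Real.Gamma (-(α / 2))| *
      ∫ t in Ioi (0 : ℝ), min (2 * N * t) 1 / t ^ (1 + α / 2)) := by
  have h1 := hasSum_mul_fracDiscWeight hα hh (c := fun β => min (‖gridPoint h β‖ ^ 2) 1)
    (M := 1) (S := fun t => discHeatSemigroup h t (fun x : 𝔼 => min (‖x‖ ^ 2) 1) 0)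
    (fun β => abs_min_sq_norm_le _) fun t ht => (hasSum_ne_zero_iff
      (f := fun β => min (‖gridPoint h β‖ ^ 2) 1 * latticeHeatKernel β (t / h ^ 2))
      (by simp [gridPoint_zero])).mpr (hasSum_min_sq_norm_mul_latticeHeatKernel h t)
  rw [← ENNReal.ofReal_tsum_of_nonneg
    (fun β => mul_nonneg (by positivity) (fracDiscWeight_nonneg hh _)) h1.summable, h1.tsum_eq]
  refine ENNReal.ofReal_le_ofReal (mul_le_mul_of_nonneg_left ?_ (by positivity))
  have hi : IntegrableOn (fun t : ℝ => min (2 * N * t) 1 / t ^ (1 + α / 2)) (Ioi 0) :=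
    integrableOn_div_rpow_of_le_min hα (by fun_prop : Measurable _).aestronglyMeasurable
        fun t ht => (abs_of_nonneg (by positivity)).le
  have hi' := integrableOn_discHeatSemigroup_sub hα hh (abs_min_sq_norm_le (N := N)) 0
  refine setIntegral_mono_on (by simpa using hi') hi measurableSet_Ioi fun t ht => ?_
  have ht0 : (0 : ℝ) < t := ht
  gcongr
  exact discHeatSemigroup_min_sq_norm_le hh ht0.le

/-! ### The standard Gaussian density -/

/-- The standard Gaussian density on `ℝ^N`. -/
def gaussDensity (z : 𝔼) : ℝ :=
  (2 * Real.pi) ^ (-((N : ℝ) / 2)) * Real.exp (-(1 / 2) * ‖z‖ ^ 2)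

theorem gaussDensity_pos (z : 𝔼) : 0 < gaussDensity z := by
  unfold gaussDensity; positivity

theorem continuous_gaussDensity : Continuous (gaussDensity : 𝔼 → ℝ) := by
  unfold gaussDensity; fun_prop

theorem integrable_exp_neg_mul_sq_norm {b : ℝ} (hb : 0 < b) :
    Integrable fun z : 𝔼 => Real.exp (-b * ‖z‖ ^ 2) := by
  -- The integral of a non-integrable function is `0` by convention, whereas the Gaussian integral
  -- formula gives a positive value.
  by_contra h
  have h1 := GaussianFourier.integral_rexp_neg_mul_sq_norm (V := 𝔼) hb
  rw [integral_undef h] at h1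
  have : 0 < (Real.pi / b) ^ ((Module.finrank ℝ 𝔼 : ℝ) / 2) := by positivity
  exact this.ne h1

theorem integrable_gaussDensity : Integrable (gaussDensity : 𝔼 → ℝ) :=
  (integrable_exp_neg_mul_sq_norm (by norm_num)).const_mul _

theorem integral_gaussDensity : ∫ z : 𝔼, gaussDensity z = 1 := by
  simp only [gaussDensity]
  rw [integral_const_mul, GaussianFourier.integral_rexp_neg_mul_sq_norm (by norm_num),
    finrank_euclideanSpace_fin, Real.rpow_neg (by positivity),
    show Real.pi / (1 / 2) = 2 * Real.pi by ring]
  exact inv_mul_cancel₀ (by positivity)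

theorem integrable_gaussDensity_mul_one_add_sq_norm :
    Integrable fun z : 𝔼 => gaussDensity z * (1 + ‖z‖ ^ 2) := by
  have hi := (integrable_exp_neg_mul_sq_norm (N := N) (b := 1 / 4) (by norm_num)).const_mul
    (5 * (2 * Real.pi) ^ (-((N : ℝ) / 2)))
  refine hi.mono' (continuous_gaussDensity.mul (by fun_prop)).aestronglyMeasurable
    (Eventually.of_forall fun z => ?_)
  rw [Real.norm_of_nonneg (mul_nonneg (gaussDensity_pos z).le (by positivity)), gaussDensity]
  have h1 : Real.exp (-(1 / 2) * ‖z‖ ^ 2)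
      = Real.exp (-(1 / 4) * ‖z‖ ^ 2) * Real.exp (-(1 / 4) * ‖z‖ ^ 2) := by
    rw [← Real.exp_add]; ring_nf
  -- Half of the Gaussian exponent absorbs the polynomial: with `s = ‖z‖²/4`, `e^{-s}(1+4s) ≤ 5`
  -- follows from `1 + s ≤ e^s`.
  have h2 : Real.exp (-(1 / 4) * ‖z‖ ^ 2) * (1 + ‖z‖ ^ 2) ≤ 5 := by
    have h3 := Real.add_one_le_exp (1 / 4 * ‖z‖ ^ 2)
    have h4 : Real.exp (-(1 / 4) * ‖z‖ ^ 2) * Real.exp (1 / 4 * ‖z‖ ^ 2) = 1 := by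
      rw [← Real.exp_add]; ring_nf; simp
    have h5 := Real.exp_pos (-(1 / 4) * ‖z‖ ^ 2)
    have h6 : Real.exp (-(1 / 4) * ‖z‖ ^ 2) ≤ 1 := by
      rw [Real.exp_le_one_iff]; nlinarith [sq_nonneg ‖z‖]
    nlinarith [mul_le_mul_of_nonneg_left h3 h5.le]
  calc _ = (2 * Real.pi) ^ (-((N : ℝ) / 2)) * Real.exp (-(1 / 4) * ‖z‖ ^ 2)
        * (Real.exp (-(1 / 4) * ‖z‖ ^ 2) * (1 + ‖z‖ ^ 2)) := by rw [h1]; ring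
    _ ≤ (2 * Real.pi) ^ (-((N : ℝ) / 2)) * Real.exp (-(1 / 4) * ‖z‖ ^ 2) * 5 := by gcongr
    _ = _ := by ring

theorem integrable_gaussDensity_mul {f : 𝔼 → ℝ} {C : ℝ} (hf : AEStronglyMeasurable f)
    (hb : ∀ z, |f z| ≤ C * (1 + ‖z‖ ^ 2)) : Integrable fun z => gaussDensity z * f z := by
  refine (integrable_gaussDensity_mul_one_add_sq_norm.const_mul C).mono'
    (continuous_gaussDensity.aestronglyMeasurable.mul hf) (Eventually.of_forall fun z => ?_)
  rw [norm_mul, Real.norm_of_nonneg (gaussDensity_pos z).le, Real.norm_eq_abs]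
  calc _ ≤ gaussDensity z * (C * (1 + ‖z‖ ^ 2)) :=
        mul_le_mul_of_nonneg_left (hb z) (gaussDensity_pos z).le
    _ = _ := by ring

theorem integrable_gaussDensity_mul_of_bounded {f : 𝔼 → ℝ} {C : ℝ} (hf : AEStronglyMeasurable f)
    (hb : ∀ z, |f z| ≤ C) : Integrable fun z => gaussDensity z * f z := by
  refine integrable_gaussDensity_mul (C := C) hf fun z => (hb z).trans ?_
  have : 0 ≤ C := (abs_nonneg _).trans (hb z)
  nlinarith [mul_nonneg this (sq_nonneg ‖z‖)]

theorem hasFDerivAt_gaussDensity (z : 𝔼) :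
    HasFDerivAt gaussDensity (-(gaussDensity z) • innerSL ℝ z) z := by
  have h1 := ((hasStrictFDerivAt_norm_sq z).hasFDerivAt.const_mul (-(1 / 2) : ℝ)).exp.const_mul
    ((2 * Real.pi) ^ (-((N : ℝ) / 2)))
  refine h1.congr_fderiv ?_
  ext v
  simp [gaussDensity]
  ring

/-- Stein's identity: integration by parts with `∂_i g = -z_i g`. Linear growth of `F` is allowed so
that `F` may itself contain a factor `z i`. -/
theorem integral_gaussDensity_mul_coord {F : 𝔼 → ℝ} {F' : 𝔼 → ℝ} {i : Fin N} {C C' : ℝ}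
    (hF : Differentiable ℝ F) (hF' : ∀ z, fderiv ℝ F z (EuclideanSpace.single i 1) = F' z)
    (hm : AEStronglyMeasurable F')
    (hb : ∀ z, |F z| ≤ C * (1 + ‖z‖)) (hb' : ∀ z, |F' z| ≤ C' * (1 + ‖z‖ ^ 2)) :
    ∫ z : 𝔼, gaussDensity z * (z i * F z) = ∫ z, gaussDensity z * F' z := by
  have hC : 0 ≤ C := by simpa using (abs_nonneg _).trans (hb 0)
  have hz : ∀ z : 𝔼, |z i| ≤ ‖z‖ := fun z => PiLp.norm_apply_le z i
  have hg : ∀ z : 𝔼, fderiv ℝ gaussDensity z (EuclideanSpace.single i 1)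
      = -(gaussDensity z * z i) := by
    intro z
    rw [(hasFDerivAt_gaussDensity z).fderiv]
    simp [EuclideanSpace.inner_single_right]
  have h1 := integral_mul_fderiv_eq_neg_fderiv_mul_of_integrable (μ := (volume : Measure 𝔼))
    (f := F) (g := gaussDensity) (v := EuclideanSpace.single i (1 : ℝ)) ?_ ?_ ?_
    (fun z _ => hF z) (fun z _ => (hasFDerivAt_gaussDensity z).differentiableAt)
  · simp only [hg, hF'] at h1
    rw [← neg_inj, ← integral_neg]
    convert h1 using 1
    · exact integral_congr_ae (Eventually.of_forall fun z => by ring)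
    · congr 1
      exact integral_congr_ae (Eventually.of_forall fun z => by ring)
  · simp only [hF']
    exact (integrable_gaussDensity_mul hm hb').congr (Eventually.of_forall fun z => by ring)
  · simp only [hg]
    have : Integrable fun z : 𝔼 => gaussDensity z * (z i * F z) := by
      refine integrable_gaussDensity_mul (C := 2 * C)
        ((by fun_prop : Continuous fun z : 𝔼 => z i).mul hF.continuous).aestronglyMeasurable
        fun z => ?_
      rw [abs_mul]
      calc _ ≤ ‖z‖ * (C * (1 + ‖z‖)) := by gcongr; exacts [hz z, hb z]
        _ ≤ _ := by nlinarith [mul_nonneg hC (sq_nonneg (‖z‖ - 1)), mul_nonneg hC (sq_nonneg ‖z‖)]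
    exact this.neg.congr (Eventually.of_forall fun z => by simp only [Pi.neg_apply]; ring)
  · refine (integrable_gaussDensity_mul (C := 2 * C) hF.continuous.aestronglyMeasurable
      fun z => (hb z).trans ?_).congr (Eventually.of_forall fun z => by ring)
    nlinarith [mul_nonneg hC (sq_nonneg (‖z‖ - 1)), mul_nonneg hC (sq_nonneg ‖z‖)]

theorem fderiv_coord_mul {f : 𝔼 → ℝ} (hf : Differentiable ℝ f) (i : Fin N) (z : 𝔼) :
    fderiv ℝ (fun z : 𝔼 => z i * f z) z (EuclideanSpace.single i 1)
      = f z + z i * fderiv ℝ f z (EuclideanSpace.single i 1) := by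
  have h1 : HasFDerivAt (fun z : 𝔼 => z i) (EuclideanSpace.proj i : 𝔼 →L[ℝ] ℝ) z :=
    (EuclideanSpace.proj i : 𝔼 →L[ℝ] ℝ).hasFDerivAt
  rw [(h1.fun_mul (hf z).hasFDerivAt).fderiv]
  simp
  ring

theorem integral_gaussDensity_mul_sq_coord (i : Fin N) :
    ∫ z : 𝔼, gaussDensity z * (z i * z i) = 1 := by
  rw [integral_gaussDensity_mul_coord (F := fun z : 𝔼 => z i) (F' := fun _ => 1) (C := 1)
    (C' := 1) (by fun_prop) (fun z => ?_) aestronglyMeasurable_const (fun z => ?_) fun z => ?_]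
  · simpa using integral_gaussDensity
  · have h1 : HasFDerivAt (fun z : 𝔼 => z i) (EuclideanSpace.proj i : 𝔼 →L[ℝ] ℝ) z :=
      (EuclideanSpace.proj i : 𝔼 →L[ℝ] ℝ).hasFDerivAt
    rw [h1.fderiv]
    simp
  · have : |z i| ≤ ‖z‖ := PiLp.norm_apply_le z i
    linarith
  · simp

/-! ### Partial derivatives of test functions -/

/-- The `i`-th partial derivative. -/
def partialDeriv (i : Fin N) (f : 𝔼 → ℝ) (x : 𝔼) : ℝ := fderiv ℝ f x (EuclideanSpace.single i 1)

/-- Smooth functions with compact support. -/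
structure IsTestFunction (f : 𝔼 → ℝ) : Prop where
  contDiff : ContDiff ℝ (⊤ : ℕ∞) f
  hasCompactSupport : HasCompactSupport f

namespace IsTestFunction

theorem continuous {f : 𝔼 → ℝ} (hf : IsTestFunction f) : Continuous f := hf.contDiff.continuous

theorem differentiable {f : 𝔼 → ℝ} (hf : IsTestFunction f) : Differentiable ℝ f := hf.contDiff.differentiable (by simp)

theorem bounded {f : 𝔼 → ℝ} (hf : IsTestFunction f) : ∃ M, ∀ x, |f x| ≤ M := by
  obtain ⟨M, hM⟩ := hf.hasCompactSupport.exists_bound_of_continuous hf.continuous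
  exact ⟨M, hM⟩

theorem continuous_fderiv {f : 𝔼 → ℝ} (hf : IsTestFunction f) : Continuous (fderiv ℝ f) := hf.contDiff.continuous_fderiv (by simp)

theorem fderiv_bounded {f : 𝔼 → ℝ} (hf : IsTestFunction f) : ∃ M, ∀ x, ‖fderiv ℝ f x‖ ≤ M :=
  (hf.hasCompactSupport.fderiv (𝕜 := ℝ)).exists_bound_of_continuous hf.continuous_fderiv

theorem partialDeriv {f : 𝔼 → ℝ} (hf : IsTestFunction f) (i : Fin N) : IsTestFunction (_root_.partialDeriv i f) where
  contDiff := (hf.contDiff.fderiv_right (m := (⊤ : ℕ∞)) (by simp)).clm_apply contDiff_const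
  hasCompactSupport := hf.hasCompactSupport.fderiv_apply (𝕜 := ℝ) _

end IsTestFunction

/-! ### The heat semigroup -/

/-- The heat semigroup on `ℝ^N`, in the scaled form `∫ g(z) f(x + √(2t) z) dz`. -/
def heatSemigroup (t : ℝ) (f : 𝔼 → ℝ) (x : 𝔼) : ℝ :=
  ∫ z : 𝔼, gaussDensity z * f (x + √(2 * t) • z)

/-- In the scaled form the initial value is attained exactly, since `√(2t)` vanishes and the
Gaussian has mass one. -/
theorem heatSemigroup_zero (f : 𝔼 → ℝ) : heatSemigroup 0 f = f := by
  ext x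
  simp [heatSemigroup, integral_mul_const, integral_gaussDensity]

theorem abs_integral_gaussDensity_mul_le {f : 𝔼 → ℝ} {A : ℝ} (hA : ∀ x, |f x| ≤ A) :
    |∫ z : 𝔼, gaussDensity z * f z| ≤ A := by
  rw [← Real.norm_eq_abs]
  refine (norm_integral_le_of_norm_le (integrable_gaussDensity.mul_const A)
    (Eventually.of_forall fun z => ?_)).trans
    (by rw [integral_mul_const, integral_gaussDensity, one_mul])
  rw [norm_mul, Real.norm_of_nonneg (gaussDensity_pos z).le]
  exact mul_le_mul_of_nonneg_left (hA _) (gaussDensity_pos z).le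

theorem abs_heatSemigroup_le {f : 𝔼 → ℝ} {A : ℝ} (hA : ∀ x, |f x| ≤ A) (t : ℝ) (x : 𝔼) :
    |heatSemigroup t f x| ≤ A :=
  abs_integral_gaussDensity_mul_le fun _ => hA _

theorem continuous_heatSemigroup {f : 𝔼 → ℝ} {A : ℝ} (hf : Continuous f) (hA : ∀ x, |f x| ≤ A) :
    Continuous fun p : ℝ × 𝔼 => heatSemigroup p.1 f p.2 := by
  unfold heatSemigroup
  refine continuous_of_dominated (bound := fun z => gaussDensity z * A)
    (fun p => (continuous_gaussDensity.mul (by fun_prop)).aestronglyMeasurable)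
    (fun p => Eventually.of_forall fun z => ?_) (integrable_gaussDensity.mul_const A)
    (Eventually.of_forall fun z => by fun_prop)
  rw [norm_mul, Real.norm_of_nonneg (gaussDensity_pos z).le]
  exact mul_le_mul_of_nonneg_left (hA _) (gaussDensity_pos z).le

theorem fderiv_apply_eq_sum_partialDeriv (f : 𝔼 → ℝ) (y z : 𝔼) :
    fderiv ℝ f y z = ∑ i, z i * partialDeriv i f y := by
  conv_lhs => rw [← (EuclideanSpace.basisFun (Fin N) ℝ).sum_repr z]
  simp [partialDeriv]

theorem fderiv_comp_scale {f : 𝔼 → ℝ} (hf : Differentiable ℝ f) (x z : 𝔼) (c : ℝ) (i : Fin N) :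
    fderiv ℝ (fun z => f (x + c • z)) z (EuclideanSpace.single i 1)
      = c * partialDeriv i f (x + c • z) := by
  have h1 : HasFDerivAt (fun z : 𝔼 => x + c • z) (c • ContinuousLinearMap.id ℝ 𝔼) z :=
    ((hasFDerivAt_id z).const_smul c).const_add x
  have h2 := (hf (x + c • z)).hasFDerivAt.comp z h1
  rw [show (fun z => f (x + c • z)) = f ∘ fun z => x + c • z from rfl, h2.fderiv]
  simp [partialDeriv]

/-- Gaussian integration by parts for a scaled test function. -/
theorem integral_gaussDensity_mul_coord_comp_scale {f : 𝔼 → ℝ} (hf : IsTestFunction f) (x : 𝔼)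
    (c : ℝ) (i : Fin N) :
    ∫ z : 𝔼, gaussDensity z * (z i * f (x + c • z))
      = c * ∫ z : 𝔼, gaussDensity z * partialDeriv i f (x + c • z) := by
  obtain ⟨A, hA⟩ := hf.bounded
  obtain ⟨B, hB⟩ := (hf.partialDeriv i).bounded
  have hA0 : 0 ≤ A := (abs_nonneg _).trans (hA 0)
  have hB0 : 0 ≤ B := (abs_nonneg _).trans (hB 0)
  have hd := hf.differentiable
  have hc := (hf.partialDeriv i).continuous
  rw [integral_gaussDensity_mul_coord (C := A) (C' := |c| * B) (by fun_prop)
    (fun z => fderiv_comp_scale hf.differentiable x z c i)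
    (by fun_prop : Continuous _).aestronglyMeasurable (fun z => (hA _).trans ?_) (fun z => ?_),
    ← integral_const_mul]
  · exact integral_congr_ae (Eventually.of_forall fun z => by ring)
  · nlinarith [mul_nonneg hA0 (norm_nonneg z)]
  · rw [abs_mul]
    have := mul_le_mul_of_nonneg_left (hB (x + c • z)) (abs_nonneg c)
    nlinarith [mul_nonneg (mul_nonneg (abs_nonneg c) hB0) (sq_nonneg ‖z‖)]

theorem integral_gaussDensity_mul_sq_coord_comp_scale {f : 𝔼 → ℝ} (hf : IsTestFunction f) (x : 𝔼)
    (c : ℝ) (i : Fin N) :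
    ∫ z : 𝔼, gaussDensity z * (z i * (z i * f (x + c • z)))
      = ∫ z : 𝔼, gaussDensity z * (f (x + c • z) + z i * (c * partialDeriv i f (x + c • z))) := by
  obtain ⟨A, hA⟩ := hf.bounded
  obtain ⟨B, hB⟩ := (hf.partialDeriv i).bounded
  have hA0 : 0 ≤ A := (abs_nonneg _).trans (hA 0)
  have hB0 : 0 ≤ |c| * B := mul_nonneg (abs_nonneg c) ((abs_nonneg _).trans (hB 0))
  have hd := hf.differentiable
  have hfc := hf.continuous
  have hc := (hf.partialDeriv i).continuous
  have hz : ∀ z : 𝔼, |z i| ≤ ‖z‖ := fun z => PiLp.norm_apply_le z i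
  have hcB : ∀ z, |c * partialDeriv i f (x + c • z)| ≤ |c| * B := fun z => by
    rw [abs_mul]
    exact mul_le_mul_of_nonneg_left (hB _) (abs_nonneg c)
  have hzB : ∀ z : 𝔼, |z i * (c * partialDeriv i f (x + c • z))| ≤ ‖z‖ * (|c| * B) := fun z => by
    rw [abs_mul]
    exact mul_le_mul (hz z) (hcB z) (abs_nonneg _) (norm_nonneg _)
  refine integral_gaussDensity_mul_coord (C := A) (C' := A + |c| * B) (by fun_prop)
    (fun z => ?_) (by fun_prop : Continuous _).aestronglyMeasurable (fun z => ?_) (fun z => ?_)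
  · rw [fderiv_coord_mul (by fun_prop), fderiv_comp_scale hf.differentiable]
  · rw [abs_mul]
    calc _ ≤ ‖z‖ * A := mul_le_mul (hz z) (hA _) (abs_nonneg _) (norm_nonneg _)
      _ ≤ _ := by nlinarith
  · refine (abs_add_le _ _).trans ((add_le_add (hA _) (hzB z)).trans ?_)
    nlinarith [mul_nonneg hA0 (sq_nonneg ‖z‖), mul_nonneg hB0 (sq_nonneg (‖z‖ - 1)),
      mul_nonneg hB0 (sq_nonneg ‖z‖)]

/-- Parabolic smoothing. Two Gaussian integrations by parts give `2t e^{tΔ}∂_i²f(x) = ∫ g(z)(z_i² -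
1) f(x + √(2t) z) dz`, and `∫ g(z)(z_i² + 1) dz = 2`. Only the supremum of `f` enters. -/
theorem abs_heatSemigroup_partialDeriv_sq_le {f : 𝔼 → ℝ} (hf : IsTestFunction f) {A : ℝ}
    (hA : ∀ x, |f x| ≤ A) (i : Fin N) {t : ℝ} (ht : 0 < t) (x : 𝔼) :
    |heatSemigroup t (partialDeriv i (partialDeriv i f)) x| ≤ A / t := by
  set c := √(2 * t) with hcdef
  have hc2 : c * c = 2 * t := Real.mul_self_sqrt (by positivity)
  have hfc := hf.continuous
  have hpc := (hf.partialDeriv i).continuous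
  obtain ⟨B, hB⟩ := (hf.partialDeriv i).bounded
  have hA0 : 0 ≤ A := (abs_nonneg _).trans (hA 0)
  have hz : ∀ z : 𝔼, |z i| ≤ ‖z‖ := fun z => PiLp.norm_apply_le z i
  have h1 := integral_gaussDensity_mul_sq_coord_comp_scale hf x c i
  have h2 := integral_gaussDensity_mul_coord_comp_scale (hf.partialDeriv i) x c i
  have hz2 : ∀ z : 𝔼, z i * z i ≤ ‖z‖ ^ 2 := fun z => by
    rw [← abs_mul_abs_self, sq]; exact mul_le_mul (hz z) (hz z) (abs_nonneg _) (norm_nonneg _)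
  have i1 : Integrable fun z : 𝔼 => gaussDensity z * f (x + c • z) :=
    integrable_gaussDensity_mul_of_bounded (by fun_prop : Continuous _).aestronglyMeasurable
      fun z => hA _
  have i2 : Integrable fun z : 𝔼 => gaussDensity z * (z i * partialDeriv i f (x + c • z)) := by
    refine integrable_gaussDensity_mul (C := B) (by fun_prop : Continuous _).aestronglyMeasurable
      fun z => ?_
    have hB0 : 0 ≤ B := (abs_nonneg _).trans (hB 0)
    rw [abs_mul]
    calc _ ≤ ‖z‖ * B := mul_le_mul (hz z) (hB _) (abs_nonneg _) (norm_nonneg _)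
      _ ≤ _ := by nlinarith [mul_nonneg hB0 (sq_nonneg (‖z‖ - 1)), mul_nonneg hB0 (sq_nonneg ‖z‖)]
  have i3 : Integrable fun z : 𝔼 => gaussDensity z * (z i * (z i * f (x + c • z))) := by
    refine integrable_gaussDensity_mul (C := A) (by fun_prop : Continuous _).aestronglyMeasurable
      fun z => ?_
    rw [← mul_assoc, abs_mul, abs_mul_self]
    calc _ ≤ ‖z‖ ^ 2 * A := mul_le_mul (hz2 z) (hA _) (abs_nonneg _) (by positivity)
      _ ≤ _ := by nlinarith
  have h3 : 2 * t * heatSemigroup t (partialDeriv i (partialDeriv i f)) x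
      = (∫ z : 𝔼, gaussDensity z * (z i * (z i * f (x + c • z))))
        - ∫ z : 𝔼, gaussDensity z * f (x + c • z) := by
    have e1 : ∫ z : 𝔼, gaussDensity z * (f (x + c • z) + z i * (c * partialDeriv i f (x + c • z)))
        = (∫ z : 𝔼, gaussDensity z * f (x + c • z))
          + c * ∫ z : 𝔼, gaussDensity z * (z i * partialDeriv i f (x + c • z)) := by
      rw [← integral_const_mul, ← integral_add i1 (i2.const_mul c)]
      exact integral_congr_ae (Eventually.of_forall fun z => by ring)
    rw [h1, e1, h2, ← hc2, heatSemigroup, ← hcdef]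
    ring
  have h4 : |∫ z : 𝔼, gaussDensity z * (z i * (z i * f (x + c • z)))| ≤ A := by
    have i4 : Integrable fun z : 𝔼 => gaussDensity z * (z i * z i) :=
      integrable_gaussDensity_mul (C := 1) (by fun_prop : Continuous _).aestronglyMeasurable
        fun z => by rw [abs_mul_self]; linarith [hz2 z]
    rw [← Real.norm_eq_abs]
    refine (norm_integral_le_of_norm_le (i4.mul_const A)
      (Eventually.of_forall fun z => ?_)).trans
      (by rw [integral_mul_const, integral_gaussDensity_mul_sq_coord, one_mul])
    rw [← mul_assoc (z i), ← mul_assoc, norm_mul, Real.norm_of_nonneg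
      (mul_nonneg (gaussDensity_pos z).le (mul_self_nonneg _))]
    exact mul_le_mul_of_nonneg_left (hA _)
      (mul_nonneg (gaussDensity_pos z).le (mul_self_nonneg _))
  have h5 : |∫ z : 𝔼, gaussDensity z * f (x + c • z)| ≤ A :=
    abs_integral_gaussDensity_mul_le fun _ => hA _
  rw [le_div_iff₀ ht]
  have h6 : |2 * t * heatSemigroup t (partialDeriv i (partialDeriv i f)) x| ≤ A + A := by
    rw [h3]
    exact (abs_sub _ _).trans (add_le_add h4 h5)
  rw [abs_mul, abs_of_pos (by positivity : 0 < 2 * t)] at h6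
  linarith

theorem hasDerivAt_heatSemigroup_space {f : 𝔼 → ℝ} (hf : IsTestFunction f) (i : Fin N) (t : ℝ)
    (x : 𝔼) (r : ℝ) :
    HasDerivAt (fun r : ℝ => heatSemigroup t f (x + r • EuclideanSpace.single i (1 : ℝ)))
      (heatSemigroup t (partialDeriv i f) (x + r • EuclideanSpace.single i (1 : ℝ))) r := by
  obtain ⟨A, hA⟩ := hf.bounded
  obtain ⟨B, hB⟩ := (hf.partialDeriv i).bounded
  have hfc := hf.continuous
  have hpc := (hf.partialDeriv i).continuous
  have hgc := continuous_gaussDensity (N := N)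
  refine (hasDerivAt_integral_of_dominated_loc_of_deriv_le (s := univ)
    (F := fun (r : ℝ) (z : 𝔼) => gaussDensity z *
      f (x + r • EuclideanSpace.single i (1 : ℝ) + √(2 * t) • z))
    (F' := fun (r : ℝ) (z : 𝔼) => gaussDensity z *
      partialDeriv i f (x + r • EuclideanSpace.single i (1 : ℝ) + √(2 * t) • z))
    (bound := fun z => gaussDensity z * B) univ_mem
    (Eventually.of_forall fun r => (by fun_prop : Continuous _).aestronglyMeasurable)
    (integrable_gaussDensity_mul_of_bounded (by fun_prop : Continuous _).aestronglyMeasurable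
      fun z => hA _)
    (by fun_prop : Continuous _).aestronglyMeasurable
    (Eventually.of_forall fun z r _ => ?_) (integrable_gaussDensity.mul_const B)
    (Eventually.of_forall fun z r _ => ?_)).2
  · rw [norm_mul, Real.norm_of_nonneg (gaussDensity_pos z).le]
    exact mul_le_mul_of_nonneg_left (hB _) (gaussDensity_pos z).le
  · have h1 : HasDerivAt (fun r : ℝ => x + r • EuclideanSpace.single i (1 : ℝ) + √(2 * t) • z)
        (EuclideanSpace.single i (1 : ℝ)) r := by
      simpa using (((hasDerivAt_id r).smul_const (EuclideanSpace.single i (1 : ℝ))).const_add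
        x).add_const (√(2 * t) • z)
    exact ((hf.differentiable _).hasFDerivAt.comp_hasDerivAt r h1).const_mul _

/-- The chain rule gives `(2t)^{-1/2} z · Df` under the Gaussian, and integration by parts turns
each `z_i ∂_i f` into `√(2t) ∂_i² f`. -/
theorem hasDerivAt_heatSemigroup_time {f : 𝔼 → ℝ} (hf : IsTestFunction f) {t : ℝ} (ht : 0 < t)
    (x : 𝔼) :
    HasDerivAt (fun t => heatSemigroup t f x)
      (∑ i, heatSemigroup t (partialDeriv i (partialDeriv i f)) x) t := by
  obtain ⟨A, hA⟩ := hf.bounded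
  obtain ⟨B, hB⟩ := hf.fderiv_bounded
  have hB0 : 0 ≤ B := (norm_nonneg _).trans (hB 0)
  have hfc := hf.continuous
  have hgc := continuous_gaussDensity (N := N)
  have hdc := hf.continuous_fderiv
  have hd : ∀ s : ℝ, 0 < s → HasDerivAt (fun s : ℝ => √(2 * s)) (1 / √(2 * s)) s := by
    intro s hs
    have := ((hasDerivAt_id s).const_mul 2).sqrt (by simp [hs.ne'])
    refine this.congr_deriv ?_
    simp only [id, mul_one]
    have : 0 < √(2 * s) := by positivity
    field_simp
  -- On `s > t/2` one has `√(2s) ≥ √t`, which gives a majorant independent of `s`.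
  have main := (hasDerivAt_integral_of_dominated_loc_of_deriv_le (s := Ioi (t / 2)) (x₀ := t)
    (μ := (volume : Measure 𝔼))
    (F := fun (s : ℝ) (z : 𝔼) => gaussDensity z * f (x + √(2 * s) • z))
    (F' := fun (s : ℝ) (z : 𝔼) => gaussDensity z *
      fderiv ℝ f (x + √(2 * s) • z) ((1 / √(2 * s)) • z))
    (bound := fun z => gaussDensity z * (B * (1 / √t * ‖z‖))) (Ioi_mem_nhds (by linarith))
    (Eventually.of_forall fun r => (by fun_prop : Continuous _).aestronglyMeasurable)
    (integrable_gaussDensity_mul_of_bounded (by fun_prop : Continuous _).aestronglyMeasurable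
      fun z => hA _)
    (hgc.mul ((hdc.comp (by fun_prop)).clm_apply (by fun_prop))).aestronglyMeasurable
    (Eventually.of_forall fun z s hs => ?_) ?_
    (Eventually.of_forall fun z s hs => ?_)).2
  · refine main.congr_deriv ?_
    have hs0 : 0 < √(2 * t) := by positivity
    have hp : ∀ i : Fin N, Integrable fun z : 𝔼 =>
        gaussDensity z * (z i * partialDeriv i f (x + √(2 * t) • z)) := by
      intro i
      obtain ⟨D, hD⟩ := (hf.partialDeriv i).bounded
      have hpc := (hf.partialDeriv i).continuous
      have hD0 : 0 ≤ D := (abs_nonneg _).trans (hD 0)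
      refine integrable_gaussDensity_mul (C := D) (by fun_prop : Continuous _).aestronglyMeasurable
        fun z => ?_
      have hz : |z i| ≤ ‖z‖ := PiLp.norm_apply_le z i
      rw [abs_mul]
      calc _ ≤ ‖z‖ * D := mul_le_mul hz (hD _) (abs_nonneg _) (norm_nonneg _)
        _ ≤ _ := by nlinarith [mul_nonneg hD0 (sq_nonneg (‖z‖ - 1)), mul_nonneg hD0 (sq_nonneg ‖z‖)]
    have e1 : ∀ z : 𝔼, gaussDensity z * fderiv ℝ f (x + √(2 * t) • z) ((1 / √(2 * t)) • z)
        = (1 / √(2 * t)) * ∑ i, gaussDensity z * (z i * partialDeriv i f (x + √(2 * t) • z)) := by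
      intro z
      rw [map_smul, fderiv_apply_eq_sum_partialDeriv, smul_eq_mul, ← Finset.mul_sum]
      ring
    simp only [e1]
    rw [integral_const_mul, integral_finsetSum _ fun i _ => hp i, Finset.mul_sum]
    refine Finset.sum_congr rfl fun i _ => ?_
    rw [integral_gaussDensity_mul_coord_comp_scale (hf.partialDeriv i), heatSemigroup,
      ← mul_assoc, one_div, inv_mul_cancel₀ hs0.ne', one_mul]
  · have hs' : t / 2 < s := hs
    rw [norm_mul, Real.norm_of_nonneg (gaussDensity_pos z).le]
    refine mul_le_mul_of_nonneg_left ?_ (gaussDensity_pos z).le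
    refine ((fderiv ℝ f (x + √(2 * s) • z)).le_opNorm _).trans ?_
    rw [norm_smul, Real.norm_of_nonneg (by positivity)]
    have h1 : √t ≤ √(2 * s) := Real.sqrt_le_sqrt (by linarith)
    have h2 : 0 < √t := by positivity
    gcongr
    exact hB _
  · refine integrable_gaussDensity_mul (C := B * (1 / √t))
      (by fun_prop : Continuous _).aestronglyMeasurable fun z => ?_
    rw [abs_of_nonneg (by positivity), ← mul_assoc]
    gcongr
    nlinarith [sq_nonneg (‖z‖ - 1), sq_nonneg ‖z‖]
  · have hs0 : 0 < s := (half_pos ht).trans hs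
    have h1 : HasDerivAt (fun s : ℝ => x + √(2 * s) • z) ((1 / √(2 * s)) • z) s :=
      ((hd s hs0).smul_const z).const_add x
    exact ((hf.differentiable _).hasFDerivAt.comp_hasDerivAt s h1).const_mul _

/-! ### The truncation error of the second difference -/

/-- Integrate from `0` four times, keeping the functions symmetrized in `r ↦ -r` so that they vanish
at `0`. The successive bounds are `2Ar`, `Ar²`, `Ar³/3` and `Ar⁴/12`. -/
theorem abs_second_difference_sub_le {g₀ g₁ g₂ g₃ g₄ : ℝ → ℝ} {A h : ℝ} (hh : 0 ≤ h)
    (h₀ : ∀ r, HasDerivAt g₀ (g₁ r) r) (h₁ : ∀ r, HasDerivAt g₁ (g₂ r) r)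
    (h₂ : ∀ r, HasDerivAt g₂ (g₃ r) r) (h₃ : ∀ r, HasDerivAt g₃ (g₄ r) r)
    (hA : ∀ r, |g₄ r| ≤ A) :
    |g₀ h - 2 * g₀ 0 + g₀ (-h) - h ^ 2 * g₂ 0| ≤ A * h ^ 4 / 12 := by
  have hneg : ∀ {g g' : ℝ → ℝ}, (∀ r, HasDerivAt g (g' r) r) →
      ∀ r, HasDerivAt (fun r => g (-r)) (-g' (-r)) r := by
    intro g g' hg r
    exact ((hg (-r)).comp r (hasDerivAt_neg r)).congr_deriv (by ring)
  have cont : ∀ {g g' : ℝ → ℝ} {s : Set ℝ}, (∀ r, HasDerivAt g (g' r) r) → ContinuousOn g s :=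
    fun hg r _ => (hg r).continuousAt.continuousWithinAt
  have d3 : ∀ r, HasDerivAt (fun r => g₃ r - g₃ (-r)) (g₄ r + g₄ (-r)) r := fun r =>
    ((h₃ r).sub (hneg h₃ r)).congr_deriv (by ring)
  have d2 : ∀ r, HasDerivAt (fun r => g₂ r + g₂ (-r) - 2 * g₂ 0) (g₃ r - g₃ (-r)) r := fun r =>
    (((h₂ r).add (hneg h₂ r)).sub_const (2 * g₂ 0)).congr_deriv (by ring)
  have d1 : ∀ r, HasDerivAt (fun r => g₁ r - g₁ (-r) - 2 * g₂ 0 * r)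
      (g₂ r + g₂ (-r) - 2 * g₂ 0) r := fun r =>
    (((h₁ r).sub (hneg h₁ r)).sub ((hasDerivAt_id r).const_mul (2 * g₂ 0))).congr_deriv (by ring)
  have d0 : ∀ r, HasDerivAt (fun r => g₀ r - 2 * g₀ 0 + g₀ (-r) - r ^ 2 * g₂ 0)
      (g₁ r - g₁ (-r) - 2 * g₂ 0 * r) r := fun r =>
    ((((h₀ r).sub_const (2 * g₀ 0)).add (hneg h₀ r)).sub
      ((hasDerivAt_pow 2 r).mul_const (g₂ 0))).congr_deriv (by simp; ring)
  have b3 : ∀ r, HasDerivAt (fun r => 2 * A * r) (2 * A) r := fun r => by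
    simpa using (hasDerivAt_id r).const_mul (2 * A)
  have b2 : ∀ r, HasDerivAt (fun r => A * r ^ 2) (2 * A * r) r := fun r =>
    ((hasDerivAt_pow 2 r).const_mul A).congr_deriv (by simp; ring)
  have b1 : ∀ r, HasDerivAt (fun r => A * r ^ 3 / 3) (A * r ^ 2) r := fun r =>
    (((hasDerivAt_pow 3 r).const_mul A).div_const 3).congr_deriv (by simp; ring)
  have b0 : ∀ r, HasDerivAt (fun r => A * r ^ 4 / 12) (A * r ^ 3 / 3) r := fun r =>
    (((hasDerivAt_pow 4 r).const_mul A).div_const 12).congr_deriv (by simp; ring)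
  have e3 : ∀ r, 0 ≤ r → |g₃ r - g₃ (-r)| ≤ 2 * A * r := fun r hr =>
    abs_le_of_abs_hasDerivAt_le (f := fun r => g₃ r - g₃ (-r)) hr (cont d3) (cont b3)
      (fun t _ => d3 t) (fun t _ => b3 t) (by simp)
      fun t _ => (abs_add_le _ _).trans (by linarith [hA t, hA (-t)])
  have e2 : ∀ r, 0 ≤ r → |g₂ r + g₂ (-r) - 2 * g₂ 0| ≤ A * r ^ 2 := fun r hr =>
    abs_le_of_abs_hasDerivAt_le (f := fun r => g₂ r + g₂ (-r) - 2 * g₂ 0) hr (cont d2) (cont b2)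
      (fun t _ => d2 t) (fun t _ => b2 t) (by simp [two_mul]) fun t ht => e3 t ht.1.le
  have e1 : ∀ r, 0 ≤ r → |g₁ r - g₁ (-r) - 2 * g₂ 0 * r| ≤ A * r ^ 3 / 3 := fun r hr =>
    abs_le_of_abs_hasDerivAt_le (f := fun r => g₁ r - g₁ (-r) - 2 * g₂ 0 * r) hr (cont d1) (cont b1)
      (fun t _ => d1 t) (fun t _ => b1 t) (by simp) fun t ht => e2 t ht.1.le
  exact abs_le_of_abs_hasDerivAt_le (f := fun r => g₀ r - 2 * g₀ 0 + g₀ (-r) - r ^ 2 * g₂ 0) hh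
    (cont d0) (cont b0) (fun t _ => d0 t) (fun t _ => b0 t)
    (by simp [show g₀ 0 - 2 * g₀ 0 + g₀ 0 = 0 by ring]) fun t ht => e1 t ht.1.le

/-- This is the residual of the exact heat flow in the discrete equation. The decay in `t` is
essential: a merely bounded residual would give an error bound linear in `t`, not integrable at
infinity against `dt / t^{1+α/2}`. -/
theorem abs_sum_heatSemigroup_sub_discLaplacian_le {f : 𝔼 → ℝ} (hf : IsTestFunction f) {A h : ℝ}
    (hh : 0 < h) (h2 : ∀ i x, |partialDeriv i (partialDeriv i f) x| ≤ A)
    (h4 : ∀ i x, |partialDeriv i (partialDeriv i (partialDeriv i (partialDeriv i f))) x| ≤ A)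
    {t : ℝ} (ht : 0 < t) (x : 𝔼) :
    |(∑ i, heatSemigroup t (partialDeriv i (partialDeriv i f)) x)
      - discLaplacian h (heatSemigroup t f) x| ≤ N * A * h ^ 2 * (1 / (1 + t)) := by
  rw [discLaplacian, ← Finset.sum_sub_distrib]
  refine (Finset.abs_sum_le_sum_abs _ _).trans ?_
  refine (Finset.sum_le_card_nsmul _ _ (A * h ^ 2 * (1 / (1 + t))) fun i _ => ?_).trans
    (le_of_eq (by simp; ring))
  have hf1 := hf.partialDeriv i
  have hf2 := hf1.partialDeriv i
  have hf3 := hf2.partialDeriv i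
  have hA0 : 0 ≤ A := (abs_nonneg _).trans (h2 i 0)
  -- For `t ≤ 1` contractivity applied to the fourth derivative suffices; for `t ≥ 1` smoothing is
  -- applied to the second derivative. Both bounds lie below `2A/(1+t)`.
  have hb : ∀ y, |heatSemigroup t (partialDeriv i (partialDeriv i (partialDeriv i
      (partialDeriv i f)))) y| ≤ 2 * A * (1 / (1 + t)) := by
    intro y
    have k1 := abs_heatSemigroup_le (h4 i) t y
    have k2 := abs_heatSemigroup_partialDeriv_sq_le hf2 (h2 i) i ht y
    rcases le_total t 1 with h1 | h1
    · refine k1.trans ?_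
      rw [mul_one_div, le_div_iff₀ (by positivity)]
      nlinarith
    · refine k2.trans ?_
      rw [mul_one_div, div_le_div_iff₀ ht (by positivity)]
      nlinarith
  have key := abs_second_difference_sub_le hh.le
    (hasDerivAt_heatSemigroup_space hf i t x) (hasDerivAt_heatSemigroup_space hf1 i t x)
    (hasDerivAt_heatSemigroup_space hf2 i t x) (hasDerivAt_heatSemigroup_space hf3 i t x)
    (fun r => hb _)
  simp only [zero_smul, add_zero, neg_smul, ← sub_eq_add_neg] at key
  rw [abs_sub_comm]
  have hh2 : 0 < h ^ 2 := by positivity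
  have e : (heatSemigroup t f (x + h • EuclideanSpace.single i (1 : ℝ)) - 2 * heatSemigroup t f x
      + heatSemigroup t f (x - h • EuclideanSpace.single i (1 : ℝ))) / h ^ 2
      - heatSemigroup t (partialDeriv i (partialDeriv i f)) x
      = (heatSemigroup t f (x + h • EuclideanSpace.single i (1 : ℝ)) - 2 * heatSemigroup t f x
      + heatSemigroup t f (x - h • EuclideanSpace.single i (1 : ℝ))
      - h ^ 2 * heatSemigroup t (partialDeriv i (partialDeriv i f)) x) / h ^ 2 := by
    field_simp
  rw [e, abs_div, abs_of_pos hh2, div_le_iff₀ hh2]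
  refine key.trans ?_
  have : 0 ≤ A * (1 / (1 + t)) * h ^ 4 := by positivity
  nlinarith

/-- The error of the semi-discrete heat semigroup grows at most logarithmically in time. -/
theorem abs_heatSemigroup_sub_discHeatSemigroup_le {f : 𝔼 → ℝ} (hf : IsTestFunction f) {A h : ℝ}
    (hh : 0 < h) (h2 : ∀ i x, |partialDeriv i (partialDeriv i f) x| ≤ A)
    (h4 : ∀ i x, |partialDeriv i (partialDeriv i (partialDeriv i (partialDeriv i f))) x| ≤ A)
    {t : ℝ} (ht : 0 ≤ t) (x : 𝔼) :
    |heatSemigroup t f x - discHeatSemigroup h t f x| ≤ N * A * h ^ 2 * Real.log (1 + t) := by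
  obtain ⟨M, hM⟩ := hf.bounded
  -- The difference of the two flows starts at zero and is driven by the residual; `R` is the
  -- primitive of the residual bound `ρ`.
  refine abs_le_of_semidiscrete_heat (M := M + M) hh
    (w := fun t x => heatSemigroup t f x - discHeatSemigroup h t f x)
    (r := fun t x => (∑ i, heatSemigroup t (partialDeriv i (partialDeriv i f)) x)
      - discLaplacian h (heatSemigroup t f) x)
    (R := fun t => N * A * h ^ 2 * Real.log (1 + t))
    (ρ := fun t => N * A * h ^ 2 * (1 / (1 + t))) ht (fun x => ?_) (fun x => ?_) (fun t ht x => ?_)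
    (fun t ht x => ?_) (by simp) ?_ (fun t ht => ?_)
    (fun t ht x => abs_sum_heatSemigroup_sub_discLaplacian_le hf hh h2 h4 ht x) x
  · simp [heatSemigroup_zero, discHeatSemigroup_zero]
  · exact (((continuous_heatSemigroup hf.continuous hM).comp
      (continuous_id.prodMk continuous_const)).sub
      (continuous_discHeatSemigroup hM x)).continuousOn
  · refine ((hasDerivAt_heatSemigroup_time hf ht x).sub
      (hasDerivAt_discHeatSemigroup hM t x)).congr_deriv ?_
    rw [discLaplacian_sub]
    ring
  · exact (abs_sub _ _).trans
      (add_le_add (abs_heatSemigroup_le hM t x) (abs_discHeatSemigroup_le hh hM ht.1 x))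
  · refine ContinuousOn.mul continuousOn_const (ContinuousOn.log (by fun_prop) fun s hs => ?_)
    have : (0 : ℝ) ≤ s := hs
    positivity
  · exact (((hasDerivAt_id t).const_add 1).log (by simp; positivity)).const_mul _

/-! ### The heat kernel and the Lévy density -/

/-- The heat kernel `(4πt)^{-N/2} e^{-|z|²/(4t)}`, as a rescaled standard Gaussian density. -/
def heatKernel (t : ℝ) (z : 𝔼) : ℝ := ((√(2 * t)) ^ N)⁻¹ * gaussDensity ((√(2 * t))⁻¹ • z)

theorem heatKernel_nonneg (t : ℝ) (z : 𝔼) : 0 ≤ heatKernel t z :=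
  mul_nonneg (by positivity) (gaussDensity_pos _).le

theorem measurable_heatKernel : Measurable fun p : 𝔼 × ℝ => heatKernel p.2 p.1 := by
  have hg := continuous_gaussDensity (N := N)
  unfold heatKernel
  refine Measurable.mul (by fun_prop) (hg.measurable.comp (by fun_prop))

theorem integrable_heatKernel {t : ℝ} (ht : 0 < t) : Integrable (heatKernel t : 𝔼 → ℝ) :=
  (integrable_gaussDensity.comp_smul (inv_ne_zero (by positivity : √(2 * t) ≠ 0))).const_mul _

theorem integral_heatKernel_mul {t : ℝ} (ht : 0 < t) (F : 𝔼 → ℝ) :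
    ∫ z, heatKernel t z * F z = ∫ z, gaussDensity z * F (√(2 * t) • z) := by
  have hc : 0 < √(2 * t) := by positivity
  have h1 := Measure.integral_comp_smul (volume : Measure 𝔼) (fun z => heatKernel t z * F z)
    (√(2 * t))
  rw [finrank_euclideanSpace_fin, smul_eq_mul, abs_of_nonneg (by positivity)] at h1
  have h2 : ∀ z : 𝔼, heatKernel t (√(2 * t) • z) * F (√(2 * t) • z)
      = ((√(2 * t)) ^ N)⁻¹ * (gaussDensity z * F (√(2 * t) • z)) := by
    intro z
    rw [heatKernel, inv_smul_smul₀ hc.ne', mul_assoc]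
  simp only [h2] at h1
  rw [integral_const_mul] at h1
  exact (mul_left_cancel₀ (by positivity) h1).symm

theorem heatKernel_eq {t : ℝ} (ht : 0 < t) (z : 𝔼) :
    heatKernel t z = (4 * Real.pi) ^ (-((N : ℝ) / 2)) * t ^ (-((N : ℝ) / 2))
      * Real.exp (-(‖z‖ ^ 2 / 4 * t⁻¹)) := by
  have h2t : 0 < 2 * t := by positivity
  have h1 : ((√(2 * t)) ^ N)⁻¹ = (2 * t) ^ (-((N : ℝ) / 2)) := by
    rw [Real.sqrt_eq_rpow, ← Real.rpow_natCast, ← Real.rpow_mul h2t.le, ← Real.rpow_neg h2t.le]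
    ring_nf
  have h3 : (2 * t) ^ (-((N : ℝ) / 2)) * (2 * Real.pi) ^ (-((N : ℝ) / 2))
      = (4 * Real.pi) ^ (-((N : ℝ) / 2)) * t ^ (-((N : ℝ) / 2)) := by
    rw [← Real.mul_rpow h2t.le (by positivity), ← Real.mul_rpow (by positivity) ht.le]
    ring_nf
  rw [heatKernel, gaussDensity, h1, ← mul_assoc, h3, norm_smul, norm_inv,
    Real.norm_of_nonneg (Real.sqrt_nonneg _), mul_pow, inv_pow, Real.sq_sqrt h2t.le]
  congr 2
  field_simp
  ring

/-- The substitution `u = 1/t` turns this into a Gamma integral with exponent `(N+α)/2` and rate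
`‖z‖²/4`. The constant comes from `(4π)^{-N/2} 4^{(N+α)/2} = 2^α π^{-N/2}`. -/
theorem integral_heatKernel_div_rpow {α : ℝ} (hα : 0 < α) {z : 𝔼} (hz : z ≠ 0) :
    ∫ t in Ioi (0 : ℝ), heatKernel t z / t ^ (1 + α / 2)
      = 2 ^ α * Real.Gamma (((N : ℝ) + α) / 2) / Real.pi ^ ((N : ℝ) / 2)
        / ‖z‖ ^ ((N : ℝ) + α) := by
  have hz0 : 0 < ‖z‖ := norm_pos_iff.mpr hz
  set r := ‖z‖ ^ 2 / 4 with hr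
  have hr0 : 0 < r := by positivity
  set a := ((N : ℝ) + α) / 2 with ha
  have ha0 : 0 < a := by positivity
  have h1 := integral_comp_rpow_Ioi (fun u : ℝ => u ^ (a - 1) * Real.exp (-(r * u)))
    (p := -1) (by norm_num)
  rw [Real.integral_rpow_mul_exp_neg_mul_Ioi ha0 hr0] at h1
  have h2 : ∫ t in Ioi (0 : ℝ), heatKernel t z / t ^ (1 + α / 2)
      = (4 * Real.pi) ^ (-((N : ℝ) / 2)) * ∫ x in Ioi (0 : ℝ), (|(-1 : ℝ)| * x ^ ((-1 : ℝ) - 1)) •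
        ((x ^ (-1 : ℝ)) ^ (a - 1) * Real.exp (-(r * x ^ (-1 : ℝ)))) := by
    rw [← integral_const_mul]
    refine setIntegral_congr_fun measurableSet_Ioi fun t ht => ?_
    have ht0 : (0 : ℝ) < t := ht
    have e : t ^ (-((N : ℝ) / 2)) / t ^ (1 + α / 2)
        = t ^ ((-1 : ℝ) - 1) * (t ^ (-1 : ℝ)) ^ (a - 1) := by
      rw [← Real.rpow_sub ht0, ← Real.rpow_mul ht0.le, ← Real.rpow_add ht0, ha]
      ring_nf
    rw [heatKernel_eq ht0, smul_eq_mul, abs_neg, abs_one, one_mul, Real.rpow_neg_one t,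
      ← hr]
    rw [Real.rpow_neg_one t] at e
    calc _ = (4 * Real.pi) ^ (-((N : ℝ) / 2)) * (t ^ (-((N : ℝ) / 2)) / t ^ (1 + α / 2))
          * Real.exp (-(r * t⁻¹)) := by ring
      _ = _ := by rw [e]; ring
  rw [h2, h1]
  have e1 : (1 / r) ^ a = 4 ^ a / ‖z‖ ^ ((N : ℝ) + α) := by
    rw [hr, one_div_div, Real.div_rpow (by positivity) (by positivity), ← Real.rpow_natCast,
      ← Real.rpow_mul hz0.le, ha]
    congr 2
    push_cast
    ring
  have e2 : (4 * Real.pi) ^ (-((N : ℝ) / 2)) * 4 ^ a = 2 ^ α / Real.pi ^ ((N : ℝ) / 2) := by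
    rw [Real.mul_rpow (by norm_num) Real.pi_pos.le, mul_right_comm,
      ← Real.rpow_add (by norm_num), Real.rpow_neg Real.pi_pos.le, ← div_eq_mul_inv,
      show (4 : ℝ) = 2 ^ (2 : ℝ) by norm_num, ← Real.rpow_mul (by norm_num)]
    congr 2
    rw [ha]
    ring
  rw [e1]
  calc _ = ((4 * Real.pi) ^ (-((N : ℝ) / 2)) * 4 ^ a) * Real.Gamma a / ‖z‖ ^ ((N : ℝ) + α) := by
        ring
    _ = _ := by rw [e2]; ring

/-! ### The Lévy integrand -/

/-- The integrand of a Lévy operator. -/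
def levyIntegrand (ψ : 𝔼 → ℝ) (x z : 𝔼) : ℝ :=
  ψ (x + z) - ψ x - (Metric.closedBall 0 1).indicator (fun z => fderiv ℝ ψ x z) z

theorem levyIntegrand_zero (ψ : 𝔼 → ℝ) (x : 𝔼) : levyIntegrand ψ x 0 = 0 := by
  simp [levyIntegrand]

namespace IsTestFunction

theorem measurable_levyIntegrand {ψ : 𝔼 → ℝ} (hψ : IsTestFunction ψ) (x : 𝔼) :
    Measurable (levyIntegrand ψ x) := by
  have := hψ.continuous
  exact (by fun_prop : Measurable fun z => ψ (x + z) - ψ x).sub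
    ((fderiv ℝ ψ x).continuous.measurable.indicator Metric.isClosed_closedBall.measurableSet)

/-- The derivative is globally Lipschitz, being smooth with compact support; apply the mean value
inequality on the ball about `x` of radius `‖z‖`. -/
theorem abs_sub_fderiv_le {ψ : 𝔼 → ℝ} (hψ : IsTestFunction ψ) :
    ∃ C, ∀ x z, |ψ (x + z) - ψ x - fderiv ℝ ψ x z| ≤ C * ‖z‖ ^ 2 := by
  obtain ⟨L, hL⟩ := ContDiff.lipschitzWith_of_hasCompactSupport (𝕂 := ℝ) (n := (⊤ : ℕ∞))
    (hψ.hasCompactSupport.fderiv (𝕜 := ℝ))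
    (hψ.contDiff.fderiv_right (m := (⊤ : ℕ∞)) (by simp)) (by simp)
  refine ⟨L, fun x z => ?_⟩
  have h1 : ‖ψ (x + z) - ψ x - fderiv ℝ ψ x (x + z - x)‖ ≤ L * ‖z‖ * ‖x + z - x‖ := by
    refine (convex_closedBall x ‖z‖).norm_image_sub_le_of_norm_fderiv_le' (𝕜 := ℝ)
      (fun y _ => hψ.differentiable y) (fun y hy => ?_) (Metric.mem_closedBall_self (norm_nonneg z))
      (by simp)
    rw [← dist_eq_norm]
    exact (hL.dist_le_mul y x).trans (mul_le_mul_of_nonneg_left hy (NNReal.coe_nonneg L))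
  rw [add_sub_cancel_left, Real.norm_eq_abs] at h1
  exact h1.trans (le_of_eq (by ring))

/-- Taylor's bound serves in the unit ball and boundedness of `ψ` outside, where `1 ≤ ‖z‖²`. The
quadratic bound is used for small times, the uniform one for large times. -/
theorem abs_levyIntegrand_le {ψ : 𝔼 → ℝ} (hψ : IsTestFunction ψ) :
    ∃ C, 0 ≤ C ∧ ∀ x z, |levyIntegrand ψ x z| ≤ C ∧ |levyIntegrand ψ x z| ≤ C * ‖z‖ ^ 2 := by
  obtain ⟨C, hC⟩ := hψ.abs_sub_fderiv_le
  obtain ⟨M, hM⟩ := hψ.bounded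
  have hM0 : 0 ≤ M := (abs_nonneg _).trans (hM 0)
  have key : ∀ x z, |levyIntegrand ψ x z| ≤ max C (2 * M) ∧
      |levyIntegrand ψ x z| ≤ max C (2 * M) * ‖z‖ ^ 2 := by
    intro x z
    have hmax := le_max_left C (2 * M)
    have hmax' := le_max_right C (2 * M)
    have hmax0 : 0 ≤ max C (2 * M) := le_trans (by positivity) hmax'
    by_cases hz : z ∈ Metric.closedBall (0 : 𝔼) 1
    · rw [levyIntegrand, indicator_of_mem hz]
      rw [mem_closedBall_zero_iff] at hz
      have h1 := (hC x z).trans (mul_le_mul_of_nonneg_right hmax (sq_nonneg ‖z‖))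
      refine ⟨h1.trans ?_, h1⟩
      have : ‖z‖ ^ 2 ≤ 1 := pow_le_one₀ (norm_nonneg z) hz
      nlinarith
    · rw [levyIntegrand, indicator_of_notMem hz, sub_zero]
      rw [mem_closedBall_zero_iff, not_le] at hz
      have h1 : |ψ (x + z) - ψ x| ≤ max C (2 * M) :=
        (abs_sub _ _).trans (by linarith [hM (x + z), hM x])
      refine ⟨h1, h1.trans ?_⟩
      have : 1 ≤ ‖z‖ ^ 2 := one_le_pow₀ hz.le
      nlinarith
  exact ⟨_, le_trans (by positivity) (le_max_right C (2 * M)), key⟩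

end IsTestFunction

theorem integral_gaussDensity_mul_odd {F : 𝔼 → ℝ} (hF : ∀ z, F (-z) = -F z) :
    ∫ z, gaussDensity z * F z = 0 := by
  have h1 := integral_neg_eq_self (fun z : 𝔼 => gaussDensity z * F z) volume
  have h2 : ∀ z : 𝔼, gaussDensity (-z) * F (-z) = -(gaussDensity z * F z) := fun z => by
    rw [hF, gaussDensity, norm_neg, gaussDensity, mul_neg]
  simp only [h2, integral_neg] at h1
  linarith

/-- The compensating gradient term is odd in `z`, so its Gaussian average is zero at every scale. -/
theorem integral_gaussDensity_mul_levyIntegrand {ψ : 𝔼 → ℝ} (hψ : IsTestFunction ψ) (t : ℝ)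
    (x : 𝔼) : ∫ z, gaussDensity z * levyIntegrand ψ x (√(2 * t) • z)
      = heatSemigroup t ψ x - ψ x := by
  obtain ⟨M, hM⟩ := hψ.bounded
  have hc := hψ.continuous
  set I : 𝔼 → ℝ := (Metric.closedBall 0 1).indicator (fun z => fderiv ℝ ψ x z) with hI
  have hodd : ∀ z, I (-z) = -I z := by
    intro z
    simp only [hI, indicator, mem_closedBall_zero_iff, norm_neg, map_neg]
    split_ifs <;> simp
  have hIm : Measurable I :=
    (fderiv ℝ ψ x).continuous.measurable.indicator Metric.isClosed_closedBall.measurableSet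
  have hIb : ∀ z, |I z| ≤ ‖fderiv ℝ ψ x‖ := by
    intro z
    simp only [hI, indicator, mem_closedBall_zero_iff]
    split_ifs with h
    · exact ((fderiv ℝ ψ x).le_opNorm z).trans (mul_le_of_le_one_right (norm_nonneg _) h)
    · simp
  have i1 : Integrable fun z : 𝔼 => gaussDensity z * ψ (x + √(2 * t) • z) :=
    integrable_gaussDensity_mul_of_bounded (by fun_prop : Continuous _).aestronglyMeasurable
      fun z => hM _
  have i2 : Integrable fun z : 𝔼 => gaussDensity z * I (√(2 * t) • z) :=
    integrable_gaussDensity_mul_of_bounded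
      (hIm.comp (by fun_prop : Measurable fun z : 𝔼 => √(2 * t) • z)).aestronglyMeasurable
      fun z => hIb _
  have e : ∀ z : 𝔼, gaussDensity z * levyIntegrand ψ x (√(2 * t) • z)
      = gaussDensity z * ψ (x + √(2 * t) • z) - gaussDensity z * ψ x
        - gaussDensity z * I (√(2 * t) • z) := fun z => by
    rw [levyIntegrand, ← hI]; ring
  simp only [e]
  have i3 : Integrable fun z : 𝔼 => gaussDensity z * ψ (x + √(2 * t) • z)
      - gaussDensity z * ψ x := i1.sub (integrable_gaussDensity.mul_const _)
  rw [integral_sub i3 i2,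
    integral_sub i1 (integrable_gaussDensity.mul_const _), integral_mul_const,
    integral_gaussDensity, integral_gaussDensity_mul_odd (F := fun z => I (√(2 * t) • z))
      (fun z => by rw [smul_neg, hodd]), heatSemigroup]
  ring

/-! ### Subordination for the fractional Laplacian -/

theorem integral_gaussDensity_mul_abs_levyIntegrand_le {ψ : 𝔼 → ℝ} (hψ : IsTestFunction ψ) :
    ∃ A B, ∀ x, ∀ t, 0 < t →
      ∫ z, gaussDensity z * |levyIntegrand ψ x (√(2 * t) • z)| ≤ min (A * t) B := by
  obtain ⟨C, hC0, hC⟩ := hψ.abs_levyIntegrand_le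
  set m := ∫ z : 𝔼, gaussDensity z * (1 + ‖z‖ ^ 2)
  refine ⟨2 * C * m, C, fun x t ht => ?_⟩
  have hi : Integrable fun z => gaussDensity z * |levyIntegrand ψ x (√(2 * t) • z)| :=
    integrable_gaussDensity_mul_of_bounded
      ((hψ.measurable_levyIntegrand x).comp (by fun_prop : Measurable fun z : 𝔼 =>
        √(2 * t) • z)).norm.aestronglyMeasurable fun z => by rw [abs_abs]; exact (hC x _).1
  refine le_min ?_ ?_
  · rw [mul_right_comm, ← integral_const_mul]
    refine integral_mono hi (integrable_gaussDensity_mul_one_add_sq_norm.const_mul _) fun z => ?_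
    have h1 := (hC x (√(2 * t) • z)).2
    rw [norm_smul, Real.norm_of_nonneg (Real.sqrt_nonneg _), mul_pow,
      Real.sq_sqrt (by positivity)] at h1
    have hg := (gaussDensity_pos z).le
    calc _ ≤ gaussDensity z * (C * (2 * t * ‖z‖ ^ 2)) := mul_le_mul_of_nonneg_left h1 hg
      _ ≤ gaussDensity z * (C * (2 * t * (1 + ‖z‖ ^ 2))) := by gcongr; linarith
      _ = _ := by ring
  · exact (le_abs_self _).trans (abs_integral_gaussDensity_mul_le fun z => by
      rw [abs_abs]; exact (hC x _).1)

theorem abs_heatSemigroup_sub_le {ψ : 𝔼 → ℝ} (hψ : IsTestFunction ψ) :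
    ∃ A B, ∀ x, ∀ t, 0 < t → |heatSemigroup t ψ x - ψ x| ≤ min (A * t) B := by
  obtain ⟨A, B, h⟩ := integral_gaussDensity_mul_abs_levyIntegrand_le hψ
  refine ⟨A, B, fun x t ht => le_trans ?_ (h x t ht)⟩
  rw [← integral_gaussDensity_mul_levyIntegrand hψ]
  refine (abs_integral_le_integral_abs).trans (le_of_eq ?_)
  refine integral_congr_ae (Eventually.of_forall fun z => ?_)
  simp only [abs_mul, abs_of_pos (gaussDensity_pos z)]

theorem integrableOn_heatSemigroup_sub {α : ℝ} (hα : α ∈ Ioo (0 : ℝ) 2) {ψ : 𝔼 → ℝ}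
    (hψ : IsTestFunction ψ) (x : 𝔼) :
    IntegrableOn (fun t : ℝ => (heatSemigroup t ψ x - ψ x) / t ^ (1 + α / 2)) (Ioi 0) := by
  obtain ⟨A, B, h⟩ := abs_heatSemigroup_sub_le hψ
  obtain ⟨M, hM⟩ := hψ.bounded
  exact integrableOn_div_rpow_of_le_min hα
    (((continuous_heatSemigroup hψ.continuous hM).comp
      (continuous_id.prodMk continuous_const)).sub continuous_const).aestronglyMeasurable (h x)

/-- The hypothesis of Fubini's theorem. Integrating in `z` first and rescaling leaves a function of
`t` bounded by `min (A * t) B`, which is integrable against `dt / t^{1+α/2}`. -/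
theorem integrable_levyIntegrand_mul_heatKernel {α : ℝ} (hα : α ∈ Ioo (0 : ℝ) 2) {ψ : 𝔼 → ℝ}
    (hψ : IsTestFunction ψ) (x : 𝔼) :
    Integrable (Function.uncurry fun (z : 𝔼) (t : ℝ) =>
        levyIntegrand ψ x z * (heatKernel t z / t ^ (1 + α / 2)))
      (volume.prod (volume.restrict (Ioi (0 : ℝ)))) := by
  obtain ⟨C, hC0, hC⟩ := hψ.abs_levyIntegrand_le
  obtain ⟨A, B, hAB⟩ := integral_gaussDensity_mul_abs_levyIntegrand_le hψ
  have hF := hψ.measurable_levyIntegrand x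
  have hm : Measurable (Function.uncurry fun (z : 𝔼) (t : ℝ) =>
      levyIntegrand ψ x z * (heatKernel t z / t ^ (1 + α / 2))) :=
    (hF.comp measurable_fst).mul (measurable_heatKernel.div (by fun_prop))
  rw [integrable_prod_iff' hm.aestronglyMeasurable]
  constructor
  · refine (ae_restrict_iff' measurableSet_Ioi).mpr (Eventually.of_forall fun t ht => ?_)
    exact ((integrable_heatKernel ht).div_const (t ^ (1 + α / 2))).bdd_mul hF.aestronglyMeasurable
      (Eventually.of_forall fun z => (hC x z).1)
  · have hq : IntegrableOn (fun t : ℝ =>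
        (∫ z, gaussDensity z * |levyIntegrand ψ x (√(2 * t) • z)|) / t ^ (1 + α / 2)) (Ioi 0) := by
      refine integrableOn_div_rpow_of_le_min (A := A) (B := B) hα ?_ fun t ht => ?_
      · have : Measurable (Function.uncurry fun (t : ℝ) (z : 𝔼) =>
            gaussDensity z * |levyIntegrand ψ x (√(2 * t) • z)|) :=
          (continuous_gaussDensity.measurable.comp measurable_snd).mul
            (hF.comp (by fun_prop : Measurable fun p : ℝ × 𝔼 => √(2 * p.1) • p.2)).norm
        exact this.stronglyMeasurable.integral_prod_right.aestronglyMeasurable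
      · rw [abs_of_nonneg (integral_nonneg fun z =>
          mul_nonneg (gaussDensity_pos z).le (abs_nonneg _))]
        exact hAB x t ht
    refine hq.congr_fun (fun t ht => ?_) measurableSet_Ioi
    have ht0 : (0 : ℝ) < t := ht
    beta_reduce
    rw [← integral_heatKernel_mul ht0 (fun z => |levyIntegrand ψ x z|), ← integral_div]
    refine integral_congr_ae (Eventually.of_forall fun z => ?_)
    simp only [Function.uncurry_apply_pair, norm_mul, norm_div, Real.norm_eq_abs,
      abs_of_nonneg (heatKernel_nonneg t z), abs_of_pos (Real.rpow_pos_of_pos ht0 (1 + α / 2))]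
    ring

/-- The Lévy operator of the fractional Laplacian is subordinate to the heat semigroup. -/
theorem levyOperator_fracLevyMeasure_eq {α : ℝ} (hα : α ∈ Ioo (0 : ℝ) 2) {ψ : 𝔼 → ℝ}
    (hψ : IsTestFunction ψ) (x : 𝔼) :
    levyOperator (fracLevyMeasure N α) ψ x = 1 / |Real.Gamma (-(α / 2))| *
      ∫ t in Ioi (0 : ℝ), (heatSemigroup t ψ x - ψ x) / t ^ (1 + α / 2) := by
  set G := |Real.Gamma (-(α / 2))| with hG
  set k : 𝔼 → ℝ := fun z => 2 ^ α * Real.Gamma (((N : ℝ) + α) / 2)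
      / (Real.pi ^ ((N : ℝ) / 2) * G) / ‖z‖ ^ ((N : ℝ) + α) with hk
  have hα0 := hα.1
  have hΓ : 0 < Real.Gamma (((N : ℝ) + α) / 2) := Real.Gamma_pos_of_pos (by positivity)
  have hk0 : ∀ z, 0 ≤ k z := fun z => by positivity
  have hkm : Measurable k := by fun_prop
  have h1 : levyOperator (fracLevyMeasure N α) ψ x = ∫ z, k z * levyIntegrand ψ x z := by
    change ∫ z in ({0}ᶜ : Set 𝔼), levyIntegrand ψ x z
      ∂(volume.withDensity fun z => ENNReal.ofReal (k z)) = _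
    rw [setIntegral_eq_integral_of_forall_compl_eq_zero, integral_withDensity_eq_integral_toReal_smul
      (by fun_prop) (Eventually.of_forall fun z => ENNReal.ofReal_lt_top)]
    · simp only [ENNReal.toReal_ofReal (hk0 _), smul_eq_mul]
    · intro z hz
      rw [notMem_compl_iff, mem_singleton_iff] at hz
      rw [hz, levyIntegrand_zero]
  -- The density becomes a time integral of heat kernels. That formula needs `z ≠ 0`; at the origin
  -- the Lévy integrand vanishes.
  have h2 : ∀ z, k z * levyIntegrand ψ x z = 1 / G *
      ∫ t in Ioi (0 : ℝ), levyIntegrand ψ x z * (heatKernel t z / t ^ (1 + α / 2)) := by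
    intro z
    rcases eq_or_ne z 0 with rfl | hz
    · simp [levyIntegrand_zero]
    · rw [integral_const_mul, integral_heatKernel_div_rpow hα0 hz, hk]
      simp only [div_eq_mul_inv, mul_inv]
      ring
  rw [h1]
  simp only [h2]
  rw [integral_const_mul, integral_integral_swap (integrable_levyIntegrand_mul_heatKernel hα hψ x)]
  congr 1
  refine setIntegral_congr_fun measurableSet_Ioi fun t ht => ?_
  beta_reduce
  rw [← integral_gaussDensity_mul_levyIntegrand hψ, ← integral_heatKernel_mul ht, ← integral_div]
  refine integral_congr_ae (Eventually.of_forall fun z => ?_)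
  ring

/-! ### The truncation error in the supremum norm -/

/-- Near `0`, `log(1+t) ≤ t`. At infinity the logarithm lies below a power `t^{α/4}`, where `α/4` is
a choice of exponent strictly between `0` and `α/2`. -/
theorem integrableOn_log_one_add_div_rpow {α : ℝ} (hα : α ∈ Ioo (0 : ℝ) 2) :
    IntegrableOn (fun t : ℝ => Real.log (1 + t) / t ^ (1 + α / 2)) (Ioi 0) := by
  have hα0 := hα.1
  have hγ : 0 < α / 4 := by positivity
  have habs : ∀ t : ℝ, 0 < t → |Real.log (1 + t)| = Real.log (1 + t) := fun t ht =>
    abs_of_nonneg (Real.log_nonneg (by linarith))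
  refine integrableOn_div_rpow (γ := α / 4) (C := max 1 (2 ^ (α / 4) / (α / 4))) hα.2 (by linarith)
    (by fun_prop : Measurable _).aestronglyMeasurable (fun t ht => ?_) (fun t ht => ?_)
  · rw [habs t ht.1]
    have h1 := Real.log_le_sub_one_of_pos (show 0 < 1 + t by linarith [ht.1])
    have h2 := mul_le_mul_of_nonneg_right (le_max_left 1 (2 ^ (α / 4) / (α / 4))) ht.1.le
    linarith
  · have ht0 : 0 < t := one_pos.trans ht
    rw [habs t ht0]
    calc _ ≤ (1 + t) ^ (α / 4) / (α / 4) := Real.log_le_rpow_div (by linarith) hγ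
      _ ≤ (2 * t) ^ (α / 4) / (α / 4) := by gcongr; linarith
      _ = 2 ^ (α / 4) / (α / 4) * t ^ (α / 4) := by
        rw [Real.mul_rpow (by norm_num) ht0.le]; ring
      _ ≤ _ := by gcongr; exact le_max_right _ _

theorem fracDiscLaplacian_sub_fracLaplacian_eq {α h : ℝ} (hα : α ∈ Ioo (0 : ℝ) 2) (hh : 0 < h)
    {ψ : 𝔼 → ℝ} (hψ : IsTestFunction ψ) (x : 𝔼) :
    fracDiscLaplacian α h ψ x - fracLaplacian α ψ x = 1 / |Real.Gamma (-(α / 2))| *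
      ∫ t in Ioi (0 : ℝ), (heatSemigroup t ψ x - discHeatSemigroup h t ψ x) / t ^ (1 + α / 2) := by
  obtain ⟨M, hM⟩ := hψ.bounded
  have e : ∀ t : ℝ, (heatSemigroup t ψ x - discHeatSemigroup h t ψ x) / t ^ (1 + α / 2)
      = (heatSemigroup t ψ x - ψ x) / t ^ (1 + α / 2)
        - (discHeatSemigroup h t ψ x - ψ x) / t ^ (1 + α / 2) := fun t => by ring
  simp only [e]
  rw [integral_sub (integrableOn_heatSemigroup_sub hα hψ x)
    (integrableOn_discHeatSemigroup_sub hα hh hM x), mul_sub,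
    ← levyOperator_fracLevyMeasure_eq hα hψ, fracLaplacian, fracDiscLaplacian,
    abs_of_neg (Gamma_neg_half_neg hα)]
  ring

/-- The constant in the estimate of the truncation error. -/
def truncationConst (N : ℕ) (α : ℝ) : ℝ :=
  1 / |Real.Gamma (-(α / 2))| * (N * ∫ t in Ioi (0 : ℝ), Real.log (1 + t) / t ^ (1 + α / 2))

theorem abs_fracDiscLaplacian_sub_fracLaplacian_le {α h A : ℝ} (hα : α ∈ Ioo (0 : ℝ) 2)
    (hh : 0 < h) {ψ : 𝔼 → ℝ} (hψ : IsTestFunction ψ)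
    (h2 : ∀ i x, |partialDeriv i (partialDeriv i ψ) x| ≤ A)
    (h4 : ∀ i x, |partialDeriv i (partialDeriv i (partialDeriv i (partialDeriv i ψ))) x| ≤ A)
    (x : 𝔼) :
    |fracDiscLaplacian α h ψ x - fracLaplacian α ψ x| ≤ truncationConst N α * A * h ^ 2 := by
  rw [fracDiscLaplacian_sub_fracLaplacian_eq hα hh hψ, abs_mul, abs_of_nonneg (by positivity),
    truncationConst, mul_assoc, mul_assoc]
  refine mul_le_mul_of_nonneg_left ?_ (by positivity)
  calc _ ≤ ∫ t in Ioi (0 : ℝ), N * A * h ^ 2 * (Real.log (1 + t) / t ^ (1 + α / 2)) := by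
        rw [← Real.norm_eq_abs]
        refine norm_integral_le_of_norm_le
          ((integrableOn_log_one_add_div_rpow hα).const_mul (N * A * h ^ 2))
          ((ae_restrict_iff' measurableSet_Ioi).mpr (Eventually.of_forall fun t ht => ?_))
        have ht0 : (0 : ℝ) < t := ht
        have hp := Real.rpow_pos_of_pos ht0 (1 + α / 2)
        rw [norm_div, Real.norm_eq_abs, Real.norm_eq_abs, abs_of_pos hp, ← mul_div_assoc]
        gcongr
        exact abs_heatSemigroup_sub_discHeatSemigroup_le hψ hh h2 h4 ht0.le x
    _ = _ := by rw [integral_const_mul]; ring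

/-! ### Averages of translates -/

/-- The average `∫ g(x) ψ(x + y) dx` of the translates of `ψ`. -/
def translateAverage (g ψ : 𝔼 → ℝ) (y : 𝔼) : ℝ := ∫ x, g x * ψ (x + y)

theorem translateAverage_eq_convolution (g ψ : 𝔼 → ℝ) :
    translateAverage g ψ
      = convolution (fun x => g (-x)) ψ (ContinuousLinearMap.lsmul ℝ ℝ) volume := by
  ext y
  rw [translateAverage, convolution_def, ← integral_neg_eq_self]
  refine integral_congr_ae (Eventually.of_forall fun x => ?_)
  simp [neg_add_eq_sub]

theorem isTestFunction_translateAverage {g ψ : 𝔼 → ℝ} (hg : Integrable g)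
    (hgc : HasCompactSupport g) (hψ : IsTestFunction ψ) : IsTestFunction (translateAverage g ψ) where
  contDiff := by
    rw [translateAverage_eq_convolution]
    exact hψ.hasCompactSupport.contDiff_convolution_right _ hg.comp_neg.locallyIntegrable
      hψ.contDiff
  hasCompactSupport := by
    rw [translateAverage_eq_convolution]
    exact (hgc.comp_homeomorph (Homeomorph.neg 𝔼)).convolution _ hψ.hasCompactSupport

theorem partialDeriv_translateAverage {g ψ : 𝔼 → ℝ} (hg : Integrable g)
    (hψ : IsTestFunction ψ) (i : Fin N) :
    partialDeriv i (translateAverage g ψ) = translateAverage g (partialDeriv i ψ) := by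
  ext y
  have hl : LocallyIntegrable (fun x => g (-x)) volume := hg.comp_neg.locallyIntegrable
  rw [translateAverage_eq_convolution, translateAverage_eq_convolution, partialDeriv,
    (hψ.hasCompactSupport.hasFDerivAt_convolution_right _ hl (hψ.contDiff.of_le (by simp))
      y).fderiv,
    convolution_precompR_apply _ hl (hψ.hasCompactSupport.fderiv (𝕜 := ℝ)) hψ.continuous_fderiv]
  rfl

theorem IsTestFunction.integrable {ψ : 𝔼 → ℝ} (hψ : IsTestFunction ψ) : Integrable ψ :=
  hψ.continuous.integrable_of_hasCompactSupport hψ.hasCompactSupport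

/-- This trades the supremum of the average for the `L¹` norm of `ψ`, independently of the support
of `g`. -/
theorem abs_translateAverage_le {g ψ : 𝔼 → ℝ} (hψ : IsTestFunction ψ) (hg : ∀ x, |g x| ≤ 1)
    (y : 𝔼) : |translateAverage g ψ y| ≤ ∫ x, |ψ x| := by
  rw [← integral_add_right_eq_self (fun x => |ψ x|) y, ← Real.norm_eq_abs]
  refine norm_integral_le_of_norm_le (hψ.integrable.norm.comp_add_right y)
    (Eventually.of_forall fun x => ?_)
  rw [norm_mul]
  exact mul_le_of_le_one_left (norm_nonneg _) (hg x)

/-- Fubini for a product that is dominated by an integrable product. -/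
theorem integral_mul_integral_swap {X Y : Type*} [MeasurableSpace X] [MeasurableSpace Y]
    {μ : Measure X} {ν : Measure Y} [SFinite μ] [SFinite ν] {g : X → ℝ} {k : Y → ℝ}
    {F : X → Y → ℝ} (hg : Integrable g μ) (hk : Integrable k ν)
    (hm : AEStronglyMeasurable (Function.uncurry F) (μ.prod ν))
    (hF : ∀ᵐ y ∂ν, ∀ x, |F x y| ≤ k y) :
    ∫ x, g x * ∫ y, F x y ∂ν ∂μ = ∫ y, ∫ x, g x * F x y ∂μ ∂ν := by
  simp only [← integral_const_mul]
  refine integral_integral_swap ((hg.mul_prod hk).mono (hg.aestronglyMeasurable.comp_fst.mul hm) ?_)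
  filter_upwards [Measure.quasiMeasurePreserving_snd.ae hF] with p hp
  rw [Function.uncurry_def, norm_mul, norm_mul]
  exact mul_le_mul_of_nonneg_left ((hp p.1).trans (le_abs_self _)) (norm_nonneg _)

theorem integrable_mul_translate {g ψ : 𝔼 → ℝ} (hg : Integrable g) (hψ : IsTestFunction ψ) (y : 𝔼) :
    Integrable fun x => g x * ψ (x + y) := by
  obtain ⟨M, hM⟩ := hψ.bounded
  have := hψ.continuous
  exact hg.mul_bdd (c := M) (by fun_prop : Continuous _).aestronglyMeasurable
    (Eventually.of_forall fun x => hM _)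

theorem integral_mul_heatSemigroup {g ψ : 𝔼 → ℝ} (hg : Integrable g) (hψ : IsTestFunction ψ)
    (t : ℝ) : ∫ x, g x * heatSemigroup t ψ x = heatSemigroup t (translateAverage g ψ) 0 := by
  obtain ⟨M, hM⟩ := hψ.bounded
  have hc := hψ.continuous
  have hgc := continuous_gaussDensity (N := N)
  simp only [heatSemigroup]
  rw [integral_mul_integral_swap hg (integrable_gaussDensity.mul_const M)
    (by fun_prop : Continuous _).aestronglyMeasurable (Eventually.of_forall fun z x => ?_)]
  · refine integral_congr_ae (Eventually.of_forall fun z => ?_)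
    simp only [translateAverage, ← integral_const_mul, zero_add]
    exact integral_congr_ae (Eventually.of_forall fun x => by ring)
  · rw [abs_mul, abs_of_pos (gaussDensity_pos z)]
    exact mul_le_mul_of_nonneg_left (hM _) (gaussDensity_pos z).le

theorem integral_mul_heatSemigroup_sub {g ψ : 𝔼 → ℝ} (hg : Integrable g) (hψ : IsTestFunction ψ)
    (t : ℝ) : ∫ x, g x * (heatSemigroup t ψ x - ψ x)
      = heatSemigroup t (translateAverage g ψ) 0 - translateAverage g ψ 0 := by
  obtain ⟨M, hM⟩ := hψ.bounded
  have i1 : Integrable fun x => g x * heatSemigroup t ψ x :=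
    hg.mul_bdd (c := M) (((continuous_heatSemigroup hψ.continuous hM).comp
      (continuous_const.prodMk continuous_id)).aestronglyMeasurable)
      (Eventually.of_forall fun x => abs_heatSemigroup_le hM t x)
  have i2 := integrable_mul_translate hg hψ 0
  rw [← integral_mul_heatSemigroup hg hψ, translateAverage, ← integral_sub i1 i2]
  exact integral_congr_ae (Eventually.of_forall fun x => by simp only [add_zero]; ring)

theorem measurable_heatSemigroup_sub_div_rpow (α : ℝ) {ψ : 𝔼 → ℝ} (hψ : IsTestFunction ψ) :
    Measurable (Function.uncurry fun (x : 𝔼) (t : ℝ) =>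
      (heatSemigroup t ψ x - ψ x) / t ^ (1 + α / 2)) := by
  obtain ⟨M, hM⟩ := hψ.bounded
  have h1 : Continuous fun p : 𝔼 × ℝ => heatSemigroup p.2 ψ p.1 - ψ p.1 :=
    ((continuous_heatSemigroup hψ.continuous hM).comp continuous_swap).sub
      (hψ.continuous.comp continuous_fst)
  exact h1.measurable.div (by fun_prop)

/-- Translation invariance together with Fubini, carried out on the subordination formula, where
`min (A * t) B` dominates uniformly in `x`. -/
theorem integral_mul_levyOperator {α : ℝ} (hα : α ∈ Ioo (0 : ℝ) 2) {g ψ : 𝔼 → ℝ}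
    (hg : Integrable g) (hgc : HasCompactSupport g) (hψ : IsTestFunction ψ) :
    ∫ x, g x * levyOperator (fracLevyMeasure N α) ψ x
      = levyOperator (fracLevyMeasure N α) (translateAverage g ψ) 0 := by
  obtain ⟨A, B, hAB⟩ := abs_heatSemigroup_sub_le hψ
  rw [levyOperator_fracLevyMeasure_eq hα (isTestFunction_translateAverage hg hgc hψ)]
  simp only [levyOperator_fracLevyMeasure_eq hα hψ, mul_left_comm (_ : ℝ) (1 / _) (_ : ℝ)]
  rw [integral_const_mul]
  congr 1
  have hk : IntegrableOn (fun t : ℝ => min (A * t) B / t ^ (1 + α / 2)) (Ioi 0) :=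
    integrableOn_div_rpow_of_le_min hα (by fun_prop : Measurable _).aestronglyMeasurable
      fun t ht => (abs_of_nonneg ((abs_nonneg _).trans (hAB 0 t ht))).le
  rw [integral_mul_integral_swap hg hk
    (measurable_heatSemigroup_sub_div_rpow α hψ).aestronglyMeasurable]
  · refine setIntegral_congr_fun measurableSet_Ioi fun t ht => ?_
    beta_reduce
    rw [← integral_mul_heatSemigroup_sub hg hψ, ← integral_div]
    exact integral_congr_ae (Eventually.of_forall fun x => by ring)
  · refine (ae_restrict_iff' measurableSet_Ioi).mpr (Eventually.of_forall fun t ht x => ?_)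
    have ht0 : (0 : ℝ) < t := ht
    rw [abs_div, abs_of_pos (Real.rpow_pos_of_pos ht0 _)]
    gcongr
    exact hAB x t ht0

/-- The discrete counterpart is simpler: the grid measure is finite and `ψ` bounded, so Fubini
applies directly to the difference formula. -/
theorem integral_mul_neg_fracDiscLaplacian {α h : ℝ} (hα : α ∈ Ioo (0 : ℝ) 2) (hh : 0 < h)
    {g ψ : 𝔼 → ℝ} (hg : Integrable g) (hgc : HasCompactSupport g) (hψ : IsTestFunction ψ) :
    ∫ x, g x * -fracDiscLaplacian α h ψ x = -fracDiscLaplacian α h (translateAverage g ψ) 0 := by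
  have hT := isTestFunction_translateAverage hg hgc hψ
  obtain ⟨M, hM⟩ := hψ.bounded
  obtain ⟨M', hM'⟩ := hT.bounded
  have hc := hψ.continuous
  have := isFiniteMeasure_gridMeasure (N := N) hα hh
  simp only [neg_fracDiscLaplacian_eq_integral hα hh hc.measurable hM,
    neg_fracDiscLaplacian_eq_integral hα hh hT.continuous.measurable hM']
  rw [integral_mul_integral_swap (k := fun _ => M + M) hg (integrable_const _)
    (by fun_prop : Continuous _).aestronglyMeasurable
    (Eventually.of_forall fun z x => (abs_sub _ _).trans (add_le_add (hM _) (hM _)))]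
  refine integral_congr_ae (Eventually.of_forall fun z => ?_)
  simp only [zero_add, translateAverage, mul_sub]
  rw [integral_sub (integrable_mul_translate hg hψ z)
    (by simpa using integrable_mul_translate hg hψ 0)]
  simp

/-! ### The truncation error in `L¹` -/

theorem measurable_fracLaplacian {α : ℝ} (hα : α ∈ Ioo (0 : ℝ) 2) {ψ : 𝔼 → ℝ}
    (hψ : IsTestFunction ψ) : Measurable (fracLaplacian α ψ) := by
  have h1 : fracLaplacian α ψ = fun x => -(1 / |Real.Gamma (-(α / 2))| *
      ∫ t in Ioi (0 : ℝ), (heatSemigroup t ψ x - ψ x) / t ^ (1 + α / 2)) := by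
    ext x
    rw [fracLaplacian, levyOperator_fracLevyMeasure_eq hα hψ]
  rw [h1]
  exact (((measurable_heatSemigroup_sub_div_rpow α hψ).stronglyMeasurable.integral_prod_right
    (ν := volume.restrict (Ioi 0))).measurable.const_mul _).neg

theorem measurable_fracDiscLaplacian {α h : ℝ} (hα : α ∈ Ioo (0 : ℝ) 2) (hh : 0 < h) {ψ : 𝔼 → ℝ}
    (hψ : IsTestFunction ψ) : Measurable (fracDiscLaplacian α h ψ) := by
  obtain ⟨M, hM⟩ := hψ.bounded
  have hc := hψ.continuous
  have := isFiniteMeasure_gridMeasure (N := N) hα hh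
  have h1 : fracDiscLaplacian α h ψ = fun x =>
      -∫ z, (ψ (x + z) - ψ x) ∂(gridMeasure h (fracDiscWeight α h)) := by
    ext x
    rw [← neg_fracDiscLaplacian_eq_integral hα hh hc.measurable hM, neg_neg]
  rw [h1]
  have hm : Measurable (Function.uncurry fun (x z : 𝔼) => ψ (x + z) - ψ x) :=
    (by fun_prop : Continuous _).measurable
  exact (hm.stronglyMeasurable.integral_prod_right
    (ν := gridMeasure h (fracDiscWeight α h))).measurable.neg

/-- The error tested against `g` is the pointwise error at `0` of the averaged test function, to
which the sup norm estimate applies. The bound `B` only makes the integrand integrable and does not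
enter the constant. -/
theorem abs_integral_mul_sub_le {α h : ℝ} (hα : α ∈ Ioo (0 : ℝ) 2) (hh : 0 < h) {g ψ : 𝔼 → ℝ}
    (hg : Integrable g) (hgc : HasCompactSupport g) (hg1 : ∀ x, |g x| ≤ 1)
    (hψ : IsTestFunction ψ) {A : ℝ}
    (h2 : ∀ i, ∫ x, |partialDeriv i (partialDeriv i ψ) x| ≤ A)
    (h4 : ∀ i, ∫ x, |partialDeriv i (partialDeriv i (partialDeriv i (partialDeriv i ψ))) x| ≤ A)
    {B : ℝ} (hB : ∀ x, |fracDiscLaplacian α h ψ x - fracLaplacian α ψ x| ≤ B) :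
    |∫ x, g x * (fracDiscLaplacian α h ψ x - fracLaplacian α ψ x)|
      ≤ truncationConst N α * A * h ^ 2 := by
  have hT := isTestFunction_translateAverage hg hgc hψ
  obtain ⟨M, hM⟩ := hψ.bounded
  have hc := hψ.continuous
  have := isFiniteMeasure_gridMeasure (N := N) hα hh
  have i1 : Integrable fun x => g x * -fracDiscLaplacian α h ψ x := by
    refine hg.mul_bdd (c := ∫ _z, (M + M) ∂(gridMeasure (N := N) h (fracDiscWeight α h)))
      (measurable_fracDiscLaplacian hα hh hψ).neg.aestronglyMeasurable
      (Eventually.of_forall fun x => ?_)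
    rw [neg_fracDiscLaplacian_eq_integral hα hh hc.measurable hM]
    exact norm_integral_le_of_norm_le (integrable_const _)
      (Eventually.of_forall fun z => (abs_sub _ _).trans (add_le_add (hM _) (hM _)))
  have i2 : Integrable fun x => g x * (fracDiscLaplacian α h ψ x - fracLaplacian α ψ x) :=
    hg.mul_bdd (c := B) ((measurable_fracDiscLaplacian hα hh hψ).sub
      (measurable_fracLaplacian hα hψ)).aestronglyMeasurable (Eventually.of_forall hB)
  have e : ∫ x, g x * (fracDiscLaplacian α h ψ x - fracLaplacian α ψ x)
      = fracDiscLaplacian α h (translateAverage g ψ) 0 - fracLaplacian α (translateAverage g ψ) 0 := by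
    have i3 : Integrable fun x => g x * levyOperator (fracLevyMeasure N α) ψ x := by
      refine (i2.add i1).congr (Eventually.of_forall fun x => ?_)
      simp only [Pi.add_apply, fracLaplacian]
      ring
    have h1 := integral_mul_levyOperator hα hg hgc hψ
    have h3 := integral_mul_neg_fracDiscLaplacian hα hh hg hgc hψ
    rw [fracLaplacian, ← h1, sub_neg_eq_add, ← neg_neg (fracDiscLaplacian α h _ 0), ← h3,
      neg_add_eq_sub, ← integral_sub i3 i1]
    refine integral_congr_ae (Eventually.of_forall fun x => ?_)
    simp only [fracLaplacian]
    ring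
  rw [e]
  refine abs_fracDiscLaplacian_sub_fracLaplacian_le hα hh hT (fun i x => ?_) (fun i x => ?_) 0
  · rw [partialDeriv_translateAverage hg hψ, partialDeriv_translateAverage hg (hψ.partialDeriv i)]
    exact (abs_translateAverage_le ((hψ.partialDeriv i).partialDeriv i) hg1 x).trans (h2 i)
  · rw [partialDeriv_translateAverage hg hψ, partialDeriv_translateAverage hg (hψ.partialDeriv i),
      partialDeriv_translateAverage hg ((hψ.partialDeriv i).partialDeriv i),
      partialDeriv_translateAverage hg (((hψ.partialDeriv i).partialDeriv i).partialDeriv i)]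
    exact (abs_translateAverage_le ((((hψ.partialDeriv i).partialDeriv i).partialDeriv
      i).partialDeriv i) hg1 x).trans (h4 i)

/-- A bound of the `L¹` norm by duality with compactly supported functions. -/
theorem eLpNorm_one_le_of_abs_integral_mul_le {D : 𝔼 → ℝ} {B C : ℝ} (hD : Measurable D)
    (hB : ∀ x, |D x| ≤ B) (hC : ∀ g : 𝔼 → ℝ, Integrable g → HasCompactSupport g →
      (∀ x, |g x| ≤ 1) → |∫ x, g x * D x| ≤ C) :
    eLpNorm D 1 volume ≤ ENNReal.ofReal C := by
  rw [eLpNorm_one_eq_lintegral_enorm]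
  have hlim := (aecover_closedBall (μ := (volume : Measure 𝔼)) (x := 0)
    tendsto_natCast_atTop_atTop).lintegral_tendsto_of_countably_generated
    (f := fun x => ‖D x‖ₑ) hD.enorm.aemeasurable
  refine le_of_tendsto' hlim fun n => ?_
  set S := Metric.closedBall (0 : 𝔼) n
  have hS : MeasurableSet S := Metric.isClosed_closedBall.measurableSet
  have hSfin : volume S ≠ ⊤ := measure_closedBall_lt_top.ne
  -- The sign of `D` cut off to a ball is an admissible test function that recovers the `L¹` norm on
  -- the ball. Exhausting by balls avoids assuming `D` integrable beforehand.
  set s : 𝔼 → ℝ := fun x => if 0 ≤ D x then 1 else -1 with hs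
  have hsm : Measurable s :=
    Measurable.ite (measurableSet_le measurable_const hD) measurable_const measurable_const
  have hs1 : ∀ x, |s x| ≤ 1 := fun x => by simp only [hs]; split_ifs <;> simp
  have hsD : ∀ x, s x * D x = |D x| := fun x => by
    simp only [hs]
    split_ifs with h
    · rw [one_mul, abs_of_nonneg h]
    · rw [neg_one_mul, abs_of_neg (not_le.mp h)]
  have hgi : Integrable (S.indicator s) :=
    (integrable_indicator_iff hS).mpr (IntegrableOn.of_bound hSfin.lt_top hsm.aestronglyMeasurable
      1 (Eventually.of_forall hs1))
  have hgc : HasCompactSupport (S.indicator s) :=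
    HasCompactSupport.of_support_subset_isCompact (isCompact_closedBall 0 (n : ℝ))
      support_indicator_subset
  have hg1 : ∀ x, |S.indicator s x| ≤ 1 := fun x => by
    by_cases hx : x ∈ S
    · rw [indicator_of_mem hx]; exact hs1 x
    · rw [indicator_of_notMem hx]; simp
  have h1 := hC _ hgi hgc hg1
  have h2 : ∫ x, S.indicator s x * D x = ∫ x in S, ‖D x‖ := by
    rw [← integral_indicator hS]
    refine integral_congr_ae (Eventually.of_forall fun x => ?_)
    by_cases hx : x ∈ S
    · simp only [indicator_of_mem hx, hsD, Real.norm_eq_abs]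
    · simp only [indicator_of_notMem hx, zero_mul]
  rw [h2] at h1
  have hDi : IntegrableOn D S :=
    IntegrableOn.of_bound hSfin.lt_top hD.aestronglyMeasurable B (Eventually.of_forall hB)
  rw [← ofReal_integral_norm_eq_lintegral_enorm hDi]
  exact ENNReal.ofReal_le_ofReal ((le_abs_self _).trans h1)

/-- The truncation error is of second order in `L¹` and in `L^∞`. -/
theorem exists_truncation_error_le {α : ℝ} (hα : α ∈ Ioo (0 : ℝ) 2) {ψ : 𝔼 → ℝ}
    (hψ : IsTestFunction ψ) {p : ℝ≥0∞} (hp : p = 1 ∨ p = ⊤) : ∃ C : ℝ, ∀ h : ℝ, 0 < h →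
      MemLp (fun x => fracDiscLaplacian α h ψ x - fracLaplacian α ψ x) p volume ∧
      eLpNorm (fun x => fracDiscLaplacian α h ψ x - fracLaplacian α ψ x) p volume
        ≤ ENNReal.ofReal (C * h ^ 2) := by
  suffices H : ∃ C : ℝ, ∀ h : ℝ, 0 < h →
      eLpNorm (fun x => fracDiscLaplacian α h ψ x - fracLaplacian α ψ x) p volume
        ≤ ENNReal.ofReal (C * h ^ 2) by
    obtain ⟨C, hC⟩ := H
    exact ⟨C, fun h hh => ⟨⟨((measurable_fracDiscLaplacian hα hh hψ).sub
      (measurable_fracLaplacian hα hψ)).aestronglyMeasurable,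
      (hC h hh).trans_lt ENNReal.ofReal_lt_top⟩, hC h hh⟩⟩
  have d2 := fun i => (hψ.partialDeriv i).partialDeriv i
  have d4 := fun i => ((d2 i).partialDeriv i).partialDeriv i
  choose A₂ hA₂ using fun i => (d2 i).bounded
  choose A₄ hA₄ using fun i => (d4 i).bounded
  -- One constant must dominate the second and fourth derivatives in all directions; sums of the
  -- individual bounds replace a maximum.
  have hle : ∀ (f : Fin N → ℝ), (∀ i, 0 ≤ f i) → ∀ i, f i ≤ ∑ j, f j := fun f hf i =>
    Finset.single_le_sum (fun j _ => hf j) (Finset.mem_univ i)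
  -- Besides settling `p = ⊤`, this provides the boundedness that the duality argument for `p = 1`
  -- requires.
  have sup : ∀ h, 0 < h → ∀ x, |fracDiscLaplacian α h ψ x - fracLaplacian α ψ x|
      ≤ truncationConst N α * (∑ i, A₂ i + ∑ i, A₄ i) * h ^ 2 := by
    have h2 : ∀ i, 0 ≤ A₂ i := fun i => (abs_nonneg _).trans (hA₂ i 0)
    have h4 : ∀ i, 0 ≤ A₄ i := fun i => (abs_nonneg _).trans (hA₄ i 0)
    intro h hh x
    refine abs_fracDiscLaplacian_sub_fracLaplacian_le hα hh hψ (fun i x => ?_) (fun i x => ?_) x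
    · linarith [hA₂ i x, hle A₂ h2 i, Finset.sum_nonneg fun i (_ : i ∈ Finset.univ) => h4 i]
    · linarith [hA₄ i x, hle A₄ h4 i, Finset.sum_nonneg fun i (_ : i ∈ Finset.univ) => h2 i]
  rcases hp with rfl | rfl
  · set a₂ : Fin N → ℝ := fun i => ∫ x, |partialDeriv i (partialDeriv i ψ) x|
    set a₄ : Fin N → ℝ := fun i =>
      ∫ x, |partialDeriv i (partialDeriv i (partialDeriv i (partialDeriv i ψ))) x|
    have h2 : ∀ i, 0 ≤ a₂ i := fun i => integral_nonneg fun x => abs_nonneg _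
    have h4 : ∀ i, 0 ≤ a₄ i := fun i => integral_nonneg fun x => abs_nonneg _
    refine ⟨truncationConst N α * (∑ i, a₂ i + ∑ i, a₄ i), fun h hh => ?_⟩
    refine eLpNorm_one_le_of_abs_integral_mul_le ((measurable_fracDiscLaplacian hα hh hψ).sub
      (measurable_fracLaplacian hα hψ)) (sup h hh) fun g hg hgc hg1 => ?_
    refine abs_integral_mul_sub_le hα hh hg hgc hg1 hψ (fun i => ?_) (fun i => ?_) (sup h hh)
    · linarith [hle a₂ h2 i, Finset.sum_nonneg fun i (_ : i ∈ Finset.univ) => h4 i]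
    · linarith [hle a₄ h4 i, Finset.sum_nonneg fun i (_ : i ∈ Finset.univ) => h2 i]
  · refine ⟨truncationConst N α * (∑ i, A₂ i + ∑ i, A₄ i), fun h hh => ?_⟩
    rw [eLpNorm_exponent_top]
    exact eLpNormEssSup_le_of_ae_bound (Eventually.of_forall (sup h hh))

theorem tendsto_eLpNorm_truncation_error {α : ℝ} (hα : α ∈ Ioo (0 : ℝ) 2) {ψ : 𝔼 → ℝ}
    (hψ : IsTestFunction ψ) :
    Tendsto (fun h => eLpNorm (fun x => -fracLaplacian α ψ x - -fracDiscLaplacian α h ψ x) 1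
      volume) (𝓝[>] 0) (𝓝 0) := by
  obtain ⟨C, hC⟩ := exists_truncation_error_le hα hψ (p := 1) (Or.inl rfl)
  have hlim : Tendsto (fun h : ℝ => ENNReal.ofReal (C * h ^ 2)) (𝓝[>] 0) (𝓝 0) := by
    have h1 : Tendsto (fun h : ℝ => ENNReal.ofReal (C * h ^ 2)) (𝓝 0)
        (𝓝 (ENNReal.ofReal (C * 0 ^ 2))) := (ENNReal.continuous_ofReal.comp
        (by fun_prop : Continuous fun h : ℝ => C * h ^ 2)).tendsto 0
    simp only [ne_eq, OfNat.ofNat_ne_zero, not_false_eq_true, zero_pow, mul_zero,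
      ENNReal.ofReal_zero] at h1
    exact h1.mono_left nhdsWithin_le_nhds
  refine tendsto_of_tendsto_of_tendsto_of_le_of_le' tendsto_const_nhds hlim
    (Eventually.of_forall fun _ => zero_le) ?_
  filter_upwards [self_mem_nhdsWithin] with h hh
  have e : (fun x => -fracLaplacian α ψ x - -fracDiscLaplacian α h ψ x)
      = fun x => fracDiscLaplacian α h ψ x - fracLaplacian α ψ x := by
    ext x; ring
  rw [e]
  exact (hC h hh).2

theorem isAdmissibleDiscretization_fracDiscLaplacian {α : ℝ} (hα : α ∈ Ioo (0 : ℝ) 2) :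
    IsAdmissibleDiscretization (fun (ψ : 𝔼 → ℝ) x => -fracLaplacian α ψ x)
      (fun h ψ x => -fracDiscLaplacian α h ψ x) (fun h => fracDiscWeight α h) where
  nonneg h hh β _ := fracDiscWeight_nonneg hh β
  symm h _ β _ := fracDiscWeight_neg α h β
  map_neg h _ := map_neg_gridMeasure h fun β _ => fracDiscWeight_neg α h β
  finite h hh := isFiniteMeasure_gridMeasure hα hh
  eq_levy h hh ψ hm hψ x := by
    obtain ⟨M, hM⟩ := hψ
    rw [restrict_compl_zero_gridMeasure hh, neg_fracDiscLaplacian_eq_integral hα hh hm hM]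
  consistent ψ hψ hc := tendsto_eLpNorm_truncation_error hα ⟨hψ, hc⟩
  uniform_levy := (iSup₂_le fun h hh =>
    tsum_min_sq_norm_mul_fracDiscWeight_le hα hh.1).trans_lt ENNReal.ofReal_lt_top

end

theorem mainTheorem1 (N : ℕ) (hN : 1 ≤ N) (α : ℝ) (hα : α ∈ Set.Ioo (0 : ℝ) 2) :
    -- `e^{tΔ_h} ψ` is the bounded solution of the semi-discrete heat equation, and `(-Δ_h)^{α/2}`
    -- is well defined by subordination and is a difference operator with the stated weights
    (∀ h : ℝ, 0 < h → ∀ ψ : EuclideanSpace ℝ (Fin N) → ℝ, (∃ M : ℝ, ∀ x, |ψ x| ≤ M) →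
      IsSemidiscreteHeatSolution h ψ (fun t => discHeatSemigroup h t ψ) ∧
      (∀ Ψ : ℝ → EuclideanSpace ℝ (Fin N) → ℝ, IsSemidiscreteHeatSolution h ψ Ψ →
        ∀ t, 0 ≤ t → Ψ t = discHeatSemigroup h t ψ) ∧
      ∀ x : EuclideanSpace ℝ (Fin N),
        IntegrableOn (fun t : ℝ => (discHeatSemigroup h t ψ x - ψ x) / t ^ (1 + α / 2))
          (Ioi 0) ∧
        HasSum (fun β : {β : Fin N → ℤ // β ≠ 0} =>
          (ψ (x + gridPoint h (β : Fin N → ℤ)) - ψ x) * fracDiscWeight α h (β : Fin N → ℤ))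
          (-fracDiscLaplacian α h ψ x)) ∧
    -- admissibility
    IsAdmissibleDiscretization (fun (ψ : EuclideanSpace ℝ (Fin N) → ℝ) x => -fracLaplacian α ψ x)
      (fun h ψ x => -fracDiscLaplacian α h ψ x) (fun h => fracDiscWeight α h) ∧
    -- local truncation error `O(h²)` in `L¹` and `L^∞`
    (∀ ψ : EuclideanSpace ℝ (Fin N) → ℝ, ContDiff ℝ (⊤ : ℕ∞) ψ → HasCompactSupport ψ →
      ∀ p : ℝ≥0∞, p = 1 ∨ p = ⊤ → ∃ C : ℝ, ∀ h : ℝ, 0 < h →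
        MemLp (fun x => fracDiscLaplacian α h ψ x - fracLaplacian α ψ x) p volume ∧
        eLpNorm (fun x => fracDiscLaplacian α h ψ x - fracLaplacian α ψ x) p volume
          ≤ ENNReal.ofReal (C * h ^ 2)) := by
  refine ⟨fun h hh ψ ⟨M, hM⟩ => ⟨isSemidiscreteHeatSolution_discHeatSemigroup hM,
    fun Ψ hΨ t ht => hΨ.unique hh (isSemidiscreteHeatSolution_discHeatSemigroup hM) ht,
    fun x => ⟨integrableOn_discHeatSemigroup_sub hα hh hM x, hasSum_fracDiscLaplacian hα hh hM x⟩⟩,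
    isAdmissibleDiscretization_fracDiscLaplacian hα, fun ψ hψ hc p hp =>
      exists_truncation_error_le hα ⟨hψ, hc⟩ hp⟩
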